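/- Let $d,m\in\mathbb N$ and let $\mathcal P_2(\mathbb R^d)$ be the set of Borel probability measures on $\mathbb R^d$ with finite second moment. For $\mu,\nu\in\mathcal P_2(\mathbb R^d)$ let $\mathcal W_2(\mu,\nu)$ be the $L^2$-Wasserstein distance and $\mathcal W_2(\mu)=\left(\int|x|^2\,\mu(dx)\right)^{1/2}$; $|\cdot|$ is the Euclidean norm and $\|B\|=\sqrt{\operatorname{trace}(BB^T)}$. Let $b:\mathbb R^d\times\mathcal P_2(\mathbb R^d)\to\mathbb R^d$ and $\sigma:\mathbb R^d\times\mathcal P_2(\mathbb R^d)\to\mathbb R^{d\times m}$, and suppose that there are real constants such that, for all $x,y\in\mathbb R^d$ and $\mu,\nu\in\mathcal P_2(\mathbb R^d)$: 1. $K_1>K_2\ge 0$ and $2\langle x-y,b(x,\mu)-b(y,\nu)\rangle+\|\sigma(x,\mu)-\sigma(y,\nu)\|^2\le -K_1|x-y|^2+K_2\mathcal W_2(\mu,\nu)^2$; 2. $L_1>0$, $\kappa\ge1$ and $|b(x,\mu)-b(y,\nu)|^2\le L_1\left[(1+|x|^{2\kappa-2}+|y|^{2\kappa-2})|x-y|^2+\mathcal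 W_2(\mu,\nu)^2\right]$; 3. $q_0\ge 20$, $L_2>0$ and $|b(0,\delta_0)|\le L_2$; 4. $a_1>a_2\ge0$, $q^*\ge 4q_0-2$, $C\ge0$ and $2\langle x,b(x,\mu)\rangle+(q^*-1)\|\sigma(x,\mu)\|^2\le -a_1|x|^2+a_2\mathcal W_2(\mu)^2+C$; 5. $0<L_\sigma<\frac{a_1-a_2}{5(2q_0-1)}$ and $\|\sigma(x,\mu)-\sigma(y,\nu)\|^2\le L_\sigma\left[|x-y|^2+\mathcal W_2(\mu,\nu)^2\right]$. Let $h_0>0$, let $p$ be real with $1\le p<\lfloor q_0/2\rfloor$, and put $$h_2=\min\left\{\tfrac1{2(K_1-K_2)},\ h_0,\ \tfrac1{p(a_1-a_2)}\right\}.$$ Then there is a constant $K_9>0$, depending only on $b$, $\sigma$, $p$, $h_0$ and the constants above, such that the following holds. Let $(\Omega,\mathcal F,\mathbb P)$ be a probability space carrying an $m$-dimensional Wiener process $W$ and an $\mathbb R^d$-valued random variable $X_0$ independent of $W$ with $\mathbb E|X_0|^{2q_0}<\infty$; let $N\ge1$, and let $(W^i,X_0^i)$, $1\le i\le N$, be independent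 and identically distributed copies of $(W,X_0)$ on $\Omega$. Let $0<h\le h_2$, $t_k=kh$, and let $(\hat X^{i,N}_k)_{k\ge0,\,1\le i\le N}$ satisfy the backward Euler scheme: almost surely, $\hat X^{i,N}_0=X^i_0$ and $$\hat X^{i,N}_{k+1}=\hat X^{i,N}_k+h\,b\left(\hat X^{i,N}_{k+1},\mu_k^{X,N}\right)+\sigma\left(\hat X^{i,N}_k,\mu_k^{X,N}\right)\left(W^i_{t_{k+1}}-W^i_{t_k}\right),\qquad \mu_k^{X,N}=\frac1N\sum_{j=1}^N\delta_{\hat X^{j,N}_k}.$$ Then, for every $k\ge0$, $$\sup_{1\le j\le N}\mathbb E\left[|\hat X^{j,N}_k|^{2p}\right]\le K_9\sup_{1\le j\le N}\mathbb E\left[1+|X_0^j|^{4p}\right]\le K_9\,\mathbb E\left[1+|X_0|^{4p}\right].$$ In particular $K_9$ does not depend on $h$, $k$ or $N$. -/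

import Mathlib

open MeasureTheory ProbabilityTheory
open scoped ENNReal NNReal

namespace MVSDE

noncomputable section

/-- The space `ℝ^d` with its Euclidean norm. -/
abbrev E (d : ℕ) : Type := EuclideanSpace ℝ (Fin d)

/-- The Hilbert-Schmidt norm `√(trace (B Bᵀ))`. -/
def hsNorm {d m : ℕ} (B : Matrix (Fin d) (Fin m) ℝ) : ℝ :=
  Real.sqrt (Matrix.trace (B * B.transpose))

/-- The product `B v` of a matrix and a Euclidean vector. -/
def mulE {d m : ℕ} (B : Matrix (Fin d) (Fin m) ℝ) (v : E m) : E d :=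
  Matrix.toEuclideanLin B v

/-- `π` is a coupling of `μ` and `ν`: its marginals are `μ` and `ν`. -/
def IsCoupling {d : ℕ} (μ ν : Measure (E d)) (π : Measure (E d × E d)) : Prop :=
  π.map Prod.fst = μ ∧ π.map Prod.snd = ν

/-- The `L^q`-Wasserstein distance, with values in `[0, ∞]`. -/
def wassersteinDist {d : ℕ} (q : ℝ) (μ ν : Measure (E d)) : ℝ≥0∞ :=
  ⨅ (π : Measure (E d × E d)) (_ : IsCoupling μ ν π),
    (∫⁻ z, ‖z.1 - z.2‖ₑ ^ q ∂π) ^ (1 / q)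

/-- The `q`-th root of the `q`-th absolute moment, with values in `[0, ∞]`. -/
def momentNorm {d : ℕ} (q : ℝ) (μ : Measure (E d)) : ℝ≥0∞ :=
  (∫⁻ x, ‖x‖ₑ ^ q ∂μ) ^ (1 / q)

/-- The space of Borel probability measures on `ℝ^d` with finite second moment. -/
def P2 (d : ℕ) : Type :=
  {μ : Measure (E d) // IsProbabilityMeasure μ ∧ momentNorm 2 μ < ∞}

/-- The `L^2`-Wasserstein distance on `P2 d`, as a real number. -/
def W2 {d : ℕ} (μ ν : P2 d) : ℝ := (wassersteinDist 2 μ.1 ν.1).toReal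

/-- The square root of the second moment of an element of `P2 d`, as a real number. -/
def M2 {d : ℕ} (μ : P2 d) : ℝ := (momentNorm 2 μ.1).toReal

/-- The Wasserstein distance of two elements of `P2 d` is finite, so that `W2` loses nothing. -/
theorem wassersteinDist_lt_top {d : ℕ} (μ ν : P2 d) : wassersteinDist 2 μ.1 ν.1 < ∞ := by
  have := μ.2.1
  have := ν.2.1
  have fin : ∀ ρ : P2 d, ∫⁻ x, ‖x‖ₑ ^ (2 : ℝ) ∂ρ.1 < ∞ := fun ρ => by
    have := ρ.2.2
    simpa [momentNorm, ENNReal.rpow_lt_top_iff_of_pos] using this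
  refine lt_of_le_of_lt (iInf₂_le (μ.1.prod ν.1) ⟨by simp, by simp⟩) ?_
  refine ENNReal.rpow_lt_top_of_nonneg (by norm_num) (ne_of_lt ?_)
  have hle : ∀ z : E d × E d, ‖z.1 - z.2‖ₑ ^ (2 : ℝ)
      ≤ 2 * ‖z.1‖ₑ ^ (2 : ℝ) + 2 * ‖z.2‖ₑ ^ (2 : ℝ) := fun z => by
    calc ‖z.1 - z.2‖ₑ ^ (2 : ℝ) ≤ (‖z.1‖ₑ + ‖z.2‖ₑ) ^ (2 : ℝ) := by
          gcongr; exact enorm_sub_le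
      _ ≤ 2 ^ ((2 : ℝ) - 1) * (‖z.1‖ₑ ^ (2 : ℝ) + ‖z.2‖ₑ ^ (2 : ℝ)) :=
          ENNReal.rpow_add_le_mul_rpow_add_rpow _ _ (by norm_num)
      _ = _ := by norm_num [mul_add]
  refine lt_of_le_of_lt (lintegral_mono hle) ?_
  rw [lintegral_add_left (by fun_prop), lintegral_const_mul _ (by fun_prop),
    lintegral_const_mul _ (by fun_prop)]
  have h1 : ∫⁻ z : E d × E d, ‖z.1‖ₑ ^ (2 : ℝ) ∂(μ.1.prod ν.1) = ∫⁻ x, ‖x‖ₑ ^ (2 : ℝ) ∂μ.1 := by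
    rw [lintegral_prod _ (by fun_prop)]; simp
  have h2 : ∫⁻ z : E d × E d, ‖z.2‖ₑ ^ (2 : ℝ) ∂(μ.1.prod ν.1) = ∫⁻ x, ‖x‖ₑ ^ (2 : ℝ) ∂ν.1 := by
    rw [lintegral_prod _ (by fun_prop)]; simp
  rw [h1, h2]
  exact ENNReal.add_lt_top.2 ⟨ENNReal.mul_lt_top (by simp) (fin μ),
    ENNReal.mul_lt_top (by simp) (fin ν)⟩

/-- The Dirac measure at `x`. -/
def dirac2 {d : ℕ} (x : E d) : P2 d :=
  ⟨Measure.dirac x, inferInstance, by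
    refine ENNReal.rpow_lt_top_of_nonneg (by norm_num) (ne_of_lt ?_)
    simp⟩

/-- The empirical measure `N⁻¹ ∑ᵢ δ_{xᵢ}` of `N ≥ 1` points. -/
def empirical {d N : ℕ} [NeZero N] (x : Fin N → E d) : P2 d :=
  ⟨(N : ℝ≥0∞)⁻¹ • ∑ i, Measure.dirac (x i),
    ⟨by
      have : (N : ℝ≥0∞) ≠ 0 := by simp [NeZero.ne N]
      simp [ENNReal.inv_mul_cancel this (by simp)]⟩,
    by
      have : (N : ℝ≥0∞) ≠ 0 := by simp [NeZero.ne N]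
      refine ENNReal.rpow_lt_top_of_nonneg (by norm_num) (ne_of_lt ?_)
      rw [lintegral_smul_measure, lintegral_finsetSum_measure]
      refine ENNReal.mul_lt_top (by simpa [pos_iff_ne_zero] using NeZero.ne N) ?_
      exact ENNReal.sum_lt_top.2 fun i _ => by simp⟩

/-- `K₁ > K₂ ≥ 0` and
`2⟨x - y, b(x,μ) - b(y,ν)⟩ + ‖σ(x,μ) - σ(y,ν)‖² ≤ -K₁|x - y|² + K₂ W₂(μ,ν)²`. -/
def ContractiveMonotone {d m : ℕ} (b : E d → P2 d → E d)
    (σ : E d → P2 d → Matrix (Fin d) (Fin m) ℝ) (K₁ K₂ : ℝ) : Prop :=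
  K₂ < K₁ ∧ 0 ≤ K₂ ∧ ∀ (x y : E d) (μ ν : P2 d),
    2 * inner ℝ (x - y) (b x μ - b y ν) + hsNorm (σ x μ - σ y ν) ^ 2
      ≤ -K₁ * ‖x - y‖ ^ 2 + K₂ * W2 μ ν ^ 2

/-- `L₁ > 0`, `κ ≥ 1` and
`|b(x,μ) - b(y,ν)|² ≤ L₁[(1 + |x|^(2κ-2) + |y|^(2κ-2))|x - y|² + W₂(μ,ν)²]`. -/
def PolyGrowthLipschitz {d : ℕ} (b : E d → P2 d → E d) (L₁ κ : ℝ) : Prop :=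
  0 < L₁ ∧ 1 ≤ κ ∧ ∀ (x y : E d) (μ ν : P2 d),
    ‖b x μ - b y ν‖ ^ 2
      ≤ L₁ * ((1 + ‖x‖ ^ (2 * κ - 2) + ‖y‖ ^ (2 * κ - 2)) * ‖x - y‖ ^ 2 + W2 μ ν ^ 2)

/-- `a₁ > a₂ ≥ 0`, `q* ≥ 4q₀ - 2`, `C ≥ 0` and
`2⟨x, b(x,μ)⟩ + (q* - 1)‖σ(x,μ)‖² ≤ -a₁|x|² + a₂ W₂(μ)² + C`. -/
def Coercive {d m : ℕ} (b : E d → P2 d → E d)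
    (σ : E d → P2 d → Matrix (Fin d) (Fin m) ℝ) (q₀ a₁ a₂ qs C : ℝ) : Prop :=
  a₂ < a₁ ∧ 0 ≤ a₂ ∧ 4 * q₀ - 2 ≤ qs ∧ 0 ≤ C ∧ ∀ (x : E d) (μ : P2 d),
    2 * inner ℝ x (b x μ) + (qs - 1) * hsNorm (σ x μ) ^ 2
      ≤ -a₁ * ‖x‖ ^ 2 + a₂ * M2 μ ^ 2 + C

/-- `0 < L_σ < (a₁ - a₂) / (5 (2 q₀ - 1))` and
`‖σ(x,μ) - σ(y,ν)‖² ≤ L_σ[|x - y|² + W₂(μ,ν)²]`. -/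
def DiffusionLipschitz {d m : ℕ} (σ : E d → P2 d → Matrix (Fin d) (Fin m) ℝ)
    (q₀ a₁ a₂ Lσ : ℝ) : Prop :=
  0 < Lσ ∧ Lσ < (a₁ - a₂) / (5 * (2 * q₀ - 1)) ∧ ∀ (x y : E d) (μ ν : P2 d),
    hsNorm (σ x μ - σ y ν) ^ 2 ≤ Lσ * (‖x - y‖ ^ 2 + W2 μ ν ^ 2)

/-- The upper bound `min {1 / (2 (K₁ - K₂)), h₀, 1 / (p (a₁ - a₂))}` for the step size. -/
def stepBound (K₁ K₂ h₀ a₁ a₂ p : ℝ) : ℝ :=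
  min (min (1 / (2 * (K₁ - K₂))) h₀) (1 / (p * (a₁ - a₂)))

/-- An `m`-dimensional Wiener process: its coordinates are independent standard real
Brownian motions. -/
structure IsWiener {Ω : Type*} [MeasurableSpace Ω] {m : ℕ} (W : ℝ≥0 → Ω → E m)
    (P : Measure Ω) : Prop where
  measurable : ∀ t, Measurable (W t)
  brownian : ∀ l : Fin m, IsBrownianReal (fun t ω => W t ω l) P
  indep : iIndepFun (fun (l : Fin m) ω (t : ℝ≥0) => W t ω l) P

/-- The pairs `(W^i, X₀^i)` are independent and identically distributed copies
of the pair `(W, X₀)`. -/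
structure IsIIDCopies {Ω : Type*} [MeasurableSpace Ω] {d m N : ℕ} (P : Measure Ω)
    (W : ℝ≥0 → Ω → E m) (X₀ : Ω → E d)
    (Wi : Fin N → ℝ≥0 → Ω → E m) (X₀i : Fin N → Ω → E d) : Prop where
  wiener : ∀ i, IsWiener (Wi i) P
  measurable : ∀ i, Measurable (X₀i i)
  indep : iIndepFun (fun i ω => ((fun t => Wi i t ω, X₀i i ω) : (ℝ≥0 → E m) × E d)) P
  identDistrib : ∀ i, IdentDistrib
    (fun ω => ((fun t => Wi i t ω, X₀i i ω) : (ℝ≥0 → E m) × E d))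
    (fun ω => ((fun t => W t ω, X₀ ω) : (ℝ≥0 → E m) × E d)) P P

/-- `X k i` are iterates of the backward Euler scheme with step size `h` for the interacting
particle system: the drift is implicit in the particle and explicit in the empirical measure. -/
structure IsBackwardEuler {Ω : Type*} [MeasurableSpace Ω] {d m N : ℕ} [NeZero N] (P : Measure Ω)
    (b : E d → P2 d → E d) (σ : E d → P2 d → Matrix (Fin d) (Fin m) ℝ)
    (Wi : Fin N → ℝ≥0 → Ω → E m) (X₀i : Fin N → Ω → E d) (h : ℝ≥0)
    (X : ℕ → Fin N → Ω → E d) : Prop where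
  init : ∀ i, ∀ᵐ ω ∂P, X 0 i ω = X₀i i ω
  step : ∀ k i, ∀ᵐ ω ∂P, X (k + 1) i ω = X k i ω
    + (h : ℝ) • b (X (k + 1) i ω) (empirical fun j => X k j ω)
    + mulE (σ (X k i ω) (empirical fun j => X k j ω))
        (Wi i (((k + 1 : ℕ) : ℝ≥0) * h) ω - Wi i ((k : ℝ≥0) * h) ω)

end

end MVSDE

open MVSDE

/-!
Let `V k = max_j ‖ |X_k^j|² ‖_{L^p}`. The bound comes from a contractive affine recursion for `V`.

Testing the implicit equation with `X_{k+1}` and using coercivity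
(`Coercive.norm_sq_le_of_implicit`) gives, pathwise,
`(1 + a₁ h) |X_{k+1}|² ≤ |X_k + σ(X_k, μ_k) ΔW|² + h a₂ W₂(μ_k)² + h C`.
The increment `ΔW` is Gaussian and independent of the state of the whole system at step `k`. For an
integer `n ≥ p` the hypercontractive inequality
`‖ |x + B ΔW|² ‖_{L^n} ≤ |x|² + (2n - 1) h ‖B‖²` holds with deterministic `x` and `B`
(`lintegral_pi_gaussianReal_le`): in dimension one it is a comparison of binomial coefficients, and
independent Gaussian directions are integrated out one after the other. Jensen's inequality lowers
the exponent to `p`. By the linear growth of `σ` and Minkowski's inequality,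
`(1 + a₁ h) V (k+1) ≤ (1 + α h) V k + h C'` with `α = 4 (2n - 1) L_σ + a₂`
(`IsBackwardEuler.eLpNorm_succ_le`). As `p < ⌊q₀/2⌋`, one can take `n ≤ q₀/2`, and then the smallness
of `L_σ` yields `α < a₁`. Hence `V k ≤ V 0 + C' / (a₁ - α)` for every `k`, `h` and `N`
(`IsBackwardEuler.eLpNorm_le`).

Integrating out the noise requires `X_k` to be measurable with respect to the past up to null sets,
although neither measurability of the iterates nor solvability of the implicit equation is assumed.
By monotonicity a solution is unique and a Lipschitz function of the data on the set where it
exists, and such a function extends to a continuous function on the whole space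
(`ContractiveMonotone.exists_continuous_solution`).
-/

namespace MVSDE

/-! ### Gaussian hypercontractivity for even integer exponents -/

theorem integrable_pow_gaussianReal (s : ℝ≥0) (k : ℕ) :
    Integrable (fun x : ℝ => x ^ k) (gaussianReal 0 s) := by
  have h := (memLp_id_gaussianReal (μ := 0) (v := s) (k : ℝ≥0)).integrable_norm_pow'
  refine (integrable_norm_iff (by fun_prop)).1 ?_
  simpa using h

theorem hasDerivAt_gaussianPDFReal (s : ℝ≥0) (x : ℝ) :
    HasDerivAt (gaussianPDFReal 0 s) (-(x / s) * gaussianPDFReal 0 s x) x := by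
  have h : HasDerivAt (fun x : ℝ => -(x - 0) ^ 2 / (2 * (s : ℝ))) (-(x / s)) x := by
    have := ((((hasDerivAt_id x).sub_const 0).pow 2).neg).div_const (2 * (s : ℝ))
    refine this.congr_deriv ?_
    simp only [id, sub_zero]
    by_cases hs : (s : ℝ) = 0
    · simp [hs]
    · field_simp
      norm_num
  have h2 := (h.exp).const_mul ((√(2 * Real.pi * s))⁻¹)
  rw [gaussianPDFReal_def]
  refine h2.congr_deriv ?_
  ring

theorem integrable_pow_mul_gaussianPDFReal {s : ℝ≥0} (hs : s ≠ 0) (k : ℕ) :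
    Integrable (fun x : ℝ => x ^ k * gaussianPDFReal 0 s x) := by
  have h := integrable_pow_gaussianReal s k
  rw [gaussianReal_of_var_ne_zero _ hs,
    integrable_withDensity_iff_integrable_smul' (by fun_prop) (by simp [gaussianPDF])] at h
  simpa [mul_comm] using h

/-- The moment recursion of the centred Gaussian law, by integration by parts against the
density. -/
theorem integral_pow_add_two_gaussianReal (s : ℝ≥0) (k : ℕ) :
    ∫ x, x ^ (k + 2) ∂gaussianReal 0 s = (k + 1) * s * ∫ x, x ^ k ∂gaussianReal 0 s := by
  by_cases hs : s = 0
  · subst hs; simp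
  have hs' : (s : ℝ) ≠ 0 := by exact_mod_cast hs
  rw [integral_gaussianReal_eq_integral_smul hs, integral_gaussianReal_eq_integral_smul hs]
  have key := integral_mul_deriv_eq_deriv_mul_of_integrable
    (u := fun x : ℝ => x ^ (k + 1)) (v := gaussianPDFReal 0 s)
    (u' := fun x => ((k + 1 : ℕ) : ℝ) * x ^ k)
    (v' := fun x => -(x / s) * gaussianPDFReal 0 s x)
    (fun x _ => by simpa using hasDerivAt_pow (k + 1) x)
    (fun x _ => hasDerivAt_gaussianPDFReal s x)
    (((integrable_pow_mul_gaussianPDFReal hs (k + 2)).const_mul (-(1 / (s : ℝ)))).congr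
      (.of_forall fun x => by simp only [Pi.mul_apply]; ring))
    (((integrable_pow_mul_gaussianPDFReal hs k).const_mul ((k + 1 : ℕ) : ℝ)).congr
      (.of_forall fun x => by simp only [Pi.mul_apply]; ring))
    (integrable_pow_mul_gaussianPDFReal hs (k + 1))
  have e1 : ∫ x, x ^ (k + 1) * (-(x / s) * gaussianPDFReal 0 s x)
      = -(1 / (s : ℝ)) * ∫ x, gaussianPDFReal 0 s x • x ^ (k + 2) := by
    rw [← integral_const_mul]; congr 1; ext x; simp only [smul_eq_mul]; ring
  have e2 : ∫ x, ((k + 1 : ℕ) : ℝ) * x ^ k * gaussianPDFReal 0 s x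
      = (k + 1) * ∫ x, gaussianPDFReal 0 s x • x ^ k := by
    rw [← integral_const_mul]; congr 1; ext x; simp only [smul_eq_mul]; push_cast; ring
  rw [e1, e2] at key
  field_simp at key
  linarith

theorem integral_pow_odd_gaussianReal (s : ℝ≥0) (j : ℕ) :
    ∫ x, x ^ (2 * j + 1) ∂gaussianReal 0 s = 0 := by
  induction j with
  | zero => simp [integral_id_gaussianReal]
  | succ j ih => rw [show 2 * (j + 1) + 1 = (2 * j + 1) + 2 by ring,
      integral_pow_add_two_gaussianReal, ih, mul_zero]

/-- Coefficientwise form of the hypercontractive bound: the even coefficients of the `2n`-th moment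
of `a + b g` are dominated by those of `(a² + (2n - 1) s b²)ⁿ`. -/
theorem choose_mul_integral_pow_le (s : ℝ≥0) (n j : ℕ) (hj : j ≤ n) :
    ((2 * n).choose (2 * j) : ℝ) * ∫ x, x ^ (2 * j) ∂gaussianReal 0 s
      ≤ n.choose j * ((2 * n - 1) * s) ^ j := by
  induction j with
  | zero => simp
  | succ j ih =>
    have ih := ih (by omega)
    have hc1 : ((2 * n).choose (2 * j + 2) : ℝ) * ((2 * j + 2) * (2 * j + 1))
        = (2 * n).choose (2 * j) * ((2 * n - 2 * j) * (2 * n - 2 * j - 1)) := by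
      have h1 := Nat.choose_succ_right_eq (2 * n) (2 * j)
      have h2 := Nat.choose_succ_right_eq (2 * n) (2 * j + 1)
      have h1' : ((2 * n).choose (2 * j + 1) : ℝ) * (2 * j + 1)
          = (2 * n).choose (2 * j) * (2 * n - 2 * j) := by
        have : ((2 * n - 2 * j : ℕ) : ℝ) = 2 * n - 2 * j := by
          rw [Nat.cast_sub (by omega)]; push_cast; ring
        rw [← this]; exact_mod_cast h1
      have h2' : ((2 * n).choose (2 * j + 2) : ℝ) * (2 * j + 2)
          = (2 * n).choose (2 * j + 1) * (2 * n - 2 * j - 1) := by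
        have : ((2 * n - (2 * j + 1) : ℕ) : ℝ) = 2 * n - 2 * j - 1 := by
          rw [Nat.cast_sub (by omega)]; push_cast; ring
        rw [← this]; exact_mod_cast h2
      linear_combination (2 * (j : ℝ) + 1) * h2' + (2 * (n : ℝ) - 2 * j - 1) * h1'
    have hc2 : (n.choose (j + 1) : ℝ) * (j + 1) = n.choose j * (n - j) := by
      have : ((n - j : ℕ) : ℝ) = n - j := by rw [Nat.cast_sub (by omega)]
      rw [← this]; exact_mod_cast Nat.choose_succ_right_eq n j
    have hjn : (j : ℝ) + 1 ≤ n := by exact_mod_cast hj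
    have hj0 : (0 : ℝ) ≤ j := j.cast_nonneg
    rw [show 2 * (j + 1) = 2 * j + 2 by ring, integral_pow_add_two_gaussianReal]
    set M := ∫ x, x ^ (2 * j) ∂gaussianReal 0 s
    have hR0 : 0 ≤ (n.choose j : ℝ) * ((2 * n - 1) * s) ^ j := by
      have : (0 : ℝ) ≤ 2 * n - 1 := by linarith
      positivity
    refine le_of_mul_le_mul_right ?_ (show (0 : ℝ) < j + 1 by positivity)
    calc ((2 * n).choose (2 * j + 2) : ℝ) * (((2 * j : ℕ) + 1) * s * M) * (j + 1)
        = ((2 * n).choose (2 * j) * M) * ((n - j) * (2 * n - 2 * j - 1) * s) := by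
          push_cast
          linear_combination (s * M / 2) * hc1
      _ ≤ (n.choose j * ((2 * n - 1) * s) ^ j) * ((n - j) * (2 * n - 1) * s) := by
          have e1 : (0 : ℝ) ≤ n - j := by linarith
          have e2 : (0 : ℝ) ≤ 2 * n - 2 * j - 1 := by linarith
          refine mul_le_mul ih ?_ (by positivity) hR0
          have : (2 * n - 2 * j - 1 : ℝ) ≤ 2 * n - 1 := by linarith
          gcongr
      _ = n.choose (j + 1) * ((2 * n - 1) * s) ^ (j + 1) * (j + 1) := by
          rw [pow_succ]
          linear_combination (-((2 * n - 1) * (s : ℝ)) ^ j * ((2 * n - 1) * s)) * hc2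

theorem sum_range_two_mul_add_one_of_odd_eq_zero (f : ℕ → ℝ) (hf : ∀ j, f (2 * j + 1) = 0) (n : ℕ) :
    ∑ i ∈ Finset.range (2 * n + 1), f i = ∑ j ∈ Finset.range (n + 1), f (2 * j) := by
  induction n with
  | zero => simp
  | succ n ih =>
    rw [show 2 * (n + 1) + 1 = 2 * n + 1 + 1 + 1 by ring, Finset.sum_range_succ,
      Finset.sum_range_succ, ih, hf, Finset.sum_range_succ _ (n + 1)]
    simp [mul_add]

/-- Hypercontractivity of a real affine function of a Gaussian variable, for even integer
exponents. -/
theorem integral_affine_pow_gaussianReal_le (s : ℝ≥0) (n : ℕ) (a b : ℝ) :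
    ∫ x, (a + b * x) ^ (2 * n) ∂gaussianReal 0 s ≤ (a ^ 2 + (2 * n - 1) * s * b ^ 2) ^ n := by
  have h1 : ∫ x, (a + b * x) ^ (2 * n) ∂gaussianReal 0 s
      = ∑ i ∈ Finset.range (2 * n + 1),
        (b ^ i * a ^ (2 * n - i) * (2 * n).choose i) * ∫ x, x ^ i ∂gaussianReal 0 s := by
    simp_rw [add_comm a, add_pow]
    rw [integral_finsetSum]
    · refine Finset.sum_congr rfl fun i _ => ?_
      rw [← integral_const_mul]
      congr 1; ext x; ring
    · intro i _
      refine ((integrable_pow_gaussianReal s i).const_mul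
        (b ^ i * a ^ (2 * n - i) * (2 * n).choose i)).congr (.of_forall fun x => ?_)
      simp only; ring
  rw [h1, sum_range_two_mul_add_one_of_odd_eq_zero _
    (fun j => by rw [integral_pow_odd_gaussianReal, mul_zero]), add_comm (a ^ 2), add_pow]
  refine Finset.sum_le_sum fun j hj => ?_
  have hj : j ≤ n := by simpa [Nat.lt_succ_iff] using hj
  have := mul_le_mul_of_nonneg_left (choose_mul_integral_pow_le s n j hj)
    (show 0 ≤ b ^ (2 * j) * a ^ (2 * n - 2 * j) by
      rw [← Nat.mul_sub, pow_mul, pow_mul]; positivity)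
  calc _ = b ^ (2 * j) * a ^ (2 * n - 2 * j)
        * (((2 * n).choose (2 * j) : ℝ) * ∫ x, x ^ (2 * j) ∂gaussianReal 0 s) := by ring
    _ ≤ _ := this
    _ = _ := by
        rw [← Nat.mul_sub, pow_mul, pow_mul a, mul_pow ((2 * n - 1) * (s : ℝ)) (b ^ 2) j]; ring

/-- Hypercontractive bound for a nonnegative quadratic polynomial `A + 2 β g + B g²`. It is a
convex combination of the two squares `(√A ± √B g)²`, which have the same law by symmetry. -/
theorem integral_quadratic_pow_gaussianReal_le (s : ℝ≥0) {n : ℕ} {A B β : ℝ}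
    (hA : 0 ≤ A) (hB : 0 ≤ B) (hβ : β ^ 2 ≤ A * B) :
    ∫ x, (A + 2 * β * x + B * x ^ 2) ^ n ∂gaussianReal 0 s
      ≤ (A + (2 * n - 1) * s * B) ^ n := by
  obtain ⟨a, ha, rfl⟩ : ∃ a, 0 ≤ a ∧ a ^ 2 = A := ⟨√A, Real.sqrt_nonneg _, Real.sq_sqrt hA⟩
  obtain ⟨b, hb, rfl⟩ : ∃ b, 0 ≤ b ∧ b ^ 2 = B := ⟨√B, Real.sqrt_nonneg _, Real.sq_sqrt hB⟩
  obtain ⟨θ, hθ1, hθ2, hθ⟩ : ∃ θ : ℝ, -1 ≤ θ ∧ θ ≤ 1 ∧ β = θ * (a * b) := by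
    have h : |β| ≤ a * b := abs_le_of_sq_le_sq (by nlinarith) (by positivity)
    rcases (mul_nonneg ha hb).eq_or_lt with h0 | h0
    · exact ⟨0, by norm_num, by norm_num, by rw [← h0] at h; simpa using h⟩
    · have := abs_le.1 h
      exact ⟨β / (a * b), by rw [le_div_iff₀ h0]; linarith, by rw [div_le_one h0]; linarith,
        (div_mul_cancel₀ _ h0.ne').symm⟩
  have hint : ∀ c : ℝ, Integrable (fun x => (a + c * x) ^ (2 * n)) (gaussianReal 0 s) := by
    intro c
    simp_rw [add_comm a, add_pow]
    refine integrable_finsetSum _ fun i _ => ?_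
    refine ((integrable_pow_gaussianReal s i).const_mul
        (c ^ i * a ^ (2 * n - i) * (2 * n).choose i)).congr (.of_forall fun x => ?_)
    simp only; ring
  have hb1 := integral_affine_pow_gaussianReal_le s n a b
  have hb2 := integral_affine_pow_gaussianReal_le s n a (-b)
  rw [neg_sq] at hb2
  calc ∫ x, (a ^ 2 + 2 * β * x + b ^ 2 * x ^ 2) ^ n ∂gaussianReal 0 s
      ≤ ∫ x, ((1 + θ) / 2 * (a + b * x) ^ (2 * n) + (1 - θ) / 2 * (a + -b * x) ^ (2 * n))
          ∂gaussianReal 0 s := by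
        refine integral_mono_of_nonneg (.of_forall fun x => ?_)
          (((hint b).const_mul _).add ((hint (-b)).const_mul _)) (.of_forall fun x => ?_)
        · have : (0 : ℝ) ≤ a ^ 2 + 2 * β * x + b ^ 2 * x ^ 2 := by
            rw [hθ]
            nlinarith [mul_nonneg (show (0 : ℝ) ≤ 1 + θ by linarith) (sq_nonneg (a + b * x)),
              mul_nonneg (show (0 : ℝ) ≤ 1 - θ by linarith) (sq_nonneg (a - b * x))]
          exact pow_nonneg this n
        · have := (convexOn_pow (𝕜 := ℝ) n).2
            (Set.mem_Ici.2 (sq_nonneg (a + b * x))) (Set.mem_Ici.2 (sq_nonneg (a + -b * x)))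
            (show 0 ≤ (1 + θ) / 2 by linarith) (show 0 ≤ (1 - θ) / 2 by linarith) (by ring)
          simp only [smul_eq_mul, ← pow_mul] at this
          refine le_trans (le_of_eq ?_) this
          rw [hθ]; ring
    _ ≤ _ := by
        rw [integral_add ((hint b).const_mul _) ((hint (-b)).const_mul _), integral_const_mul,
          integral_const_mul]
        nlinarith [mul_le_mul_of_nonneg_left hb1 (show (0 : ℝ) ≤ (1 + θ) / 2 by linarith),
          mul_le_mul_of_nonneg_left hb2 (show (0 : ℝ) ≤ (1 - θ) / 2 by linarith)]

theorem integrable_quadratic_pow_gaussianReal (s : ℝ≥0) (n : ℕ) (A B β : ℝ) :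
    Integrable (fun x => (A + 2 * β * x + B * x ^ 2) ^ n) (gaussianReal 0 s) := by
  have h : (fun x : ℝ => (A + 2 * β * x + B * x ^ 2) ^ n) = fun x => Polynomial.eval x
      ((Polynomial.C A + Polynomial.C (2 * β) * Polynomial.X
        + Polynomial.C B * Polynomial.X ^ 2) ^ n) := by
    ext x; simp
  rw [h]
  simp_rw [Polynomial.eval_eq_sum_range]
  exact integrable_finsetSum _ fun i _ => (integrable_pow_gaussianReal s i).const_mul _

/-- Hypercontractive bound for `‖x + ∑ₗ gₗ vₗ‖² + c` with independent Gaussian coefficients,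
integrating out one coefficient at a time. The additive constant `c` carries the contribution of
the coefficients that are already integrated out. -/
theorem lintegral_pi_gaussianReal_le {F : Type*} [NormedAddCommGroup F] [InnerProductSpace ℝ F]
    [MeasurableSpace F] [BorelSpace F] [SecondCountableTopology F]
    (s : ℝ≥0) {n : ℕ} (hn : 1 ≤ n) {m : ℕ} (v : Fin m → F) (x : F) {c : ℝ} (hc : 0 ≤ c) :
    ∫⁻ z : Fin m → ℝ, ENNReal.ofReal ((‖x + ∑ l, z l • v l‖ ^ 2 + c) ^ n)
        ∂Measure.pi (fun _ => gaussianReal 0 s)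
      ≤ ENNReal.ofReal ((‖x‖ ^ 2 + c + (2 * n - 1) * s * ∑ l, ‖v l‖ ^ 2) ^ n) := by
  have hn' : (0 : ℝ) ≤ 2 * n - 1 := by
    have : (1 : ℝ) ≤ n := by exact_mod_cast hn
    linarith
  induction m generalizing x c with
  | zero => simp
  | succ m ih =>
    have hmp := (measurePreserving_piFinSuccAbove (fun _ : Fin (m + 1) => gaussianReal 0 s) 0).symm
    rw [← hmp.lintegral_comp (by fun_prop)]
    rw [lintegral_prod _ (by fun_prop)]
    have hc' : 0 ≤ c + (2 * n - 1) * s * ∑ l : Fin m, ‖v l.succ‖ ^ 2 := by positivity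
    calc _ ≤ ∫⁻ t, ENNReal.ofReal ((‖x + t • v 0‖ ^ 2 + c
          + (2 * n - 1) * s * ∑ l : Fin m, ‖v l.succ‖ ^ 2) ^ n) ∂gaussianReal 0 s := by
          refine lintegral_mono fun t => ?_
          refine le_trans (le_of_eq ?_) (ih (fun l => v l.succ) (x + t • v 0) hc)
          refine lintegral_congr fun z => ?_
          simp [Fin.sum_univ_succ, add_assoc, MeasurableEquiv.piFinSuccAbove]
      _ = ENNReal.ofReal (∫ t, ((‖x‖ ^ 2 + (c + (2 * n - 1) * s * ∑ l : Fin m, ‖v l.succ‖ ^ 2))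
          + 2 * inner ℝ x (v 0) * t + ‖v 0‖ ^ 2 * t ^ 2) ^ n ∂gaussianReal 0 s) := by
          have e : ∀ t : ℝ, ((‖x‖ ^ 2 + (c + (2 * n - 1) * s * ∑ l : Fin m, ‖v l.succ‖ ^ 2))
            + 2 * inner ℝ x (v 0) * t + ‖v 0‖ ^ 2 * t ^ 2) = ‖x + t • v 0‖ ^ 2 + c
              + (2 * n - 1) * s * ∑ l : Fin m, ‖v l.succ‖ ^ 2 := by
            intro t
            rw [norm_add_sq_real, norm_smul, inner_smul_right, mul_pow, Real.norm_eq_abs, sq_abs]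
            ring
          rw [ofReal_integral_eq_lintegral_ofReal (integrable_quadratic_pow_gaussianReal ..)]
          · simp_rw [e]
          · refine .of_forall fun t => ?_
            simp only [e, Pi.zero_apply]
            positivity
      _ ≤ _ := by
          refine ENNReal.ofReal_le_ofReal ?_
          refine le_trans (integral_quadratic_pow_gaussianReal_le s (by positivity)
            (by positivity) ?_) (le_of_eq ?_)
          · have h1 := abs_real_inner_le_norm x (v 0)
            have h2 : inner ℝ x (v 0) ^ 2 ≤ (‖x‖ * ‖v 0‖) ^ 2 := sq_le_sq' (by
              have := neg_abs_le (inner ℝ x (v 0)); linarith) ((le_abs_self _).trans h1)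
            nlinarith [mul_nonneg hc' (sq_nonneg ‖v 0‖)]
          · rw [Fin.sum_univ_succ]; ring

/-! ### Wasserstein estimates for empirical measures and the coefficients -/

theorem hsNorm_sq {d m : ℕ} (B : Matrix (Fin d) (Fin m) ℝ) :
    hsNorm B ^ 2 = ∑ l, ∑ i, B i l ^ 2 := by
  have h : Matrix.trace (B * B.transpose) = ∑ l, ∑ i, B i l ^ 2 := by
    simp only [Matrix.trace, Matrix.diag, Matrix.mul_apply, Matrix.transpose_apply]
    rw [Finset.sum_comm]
    simp [sq]
  rw [hsNorm, h, Real.sq_sqrt]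
  positivity

theorem hsNorm_sq_le_two_mul_add {d m : ℕ} (A B : Matrix (Fin d) (Fin m) ℝ) :
    hsNorm A ^ 2 ≤ 2 * hsNorm (A - B) ^ 2 + 2 * hsNorm B ^ 2 := by
  simp only [hsNorm_sq, Finset.mul_sum, ← Finset.sum_add_distrib]
  refine Finset.sum_le_sum fun l _ => Finset.sum_le_sum fun i _ => ?_
  simp only [Matrix.sub_apply]
  nlinarith [sq_nonneg (A i l - 2 * B i l)]

theorem mulE_eq_sum_col {d m : ℕ} (B : Matrix (Fin d) (Fin m) ℝ) (z : E m) :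
    mulE B z = ∑ l, z l • (WithLp.toLp 2 (fun i => B i l) : E d) := by
  ext i
  simp [mulE, Matrix.toEuclideanLin, Matrix.mulVec, dotProduct, mul_comm]

theorem sum_norm_col_sq {d m : ℕ} (B : Matrix (Fin d) (Fin m) ℝ) :
    ∑ l, ‖(WithLp.toLp 2 (fun i => B i l) : E d)‖ ^ 2 = hsNorm B ^ 2 := by
  simp [hsNorm_sq, EuclideanSpace.norm_sq_eq]

theorem lintegral_empirical {d N : ℕ} [NeZero N] (x : Fin N → E d) {f : E d → ℝ≥0∞}
    (hf : Measurable f) :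
    ∫⁻ y, f y ∂(empirical x).1 = (N : ℝ≥0∞)⁻¹ * ∑ j, f (x j) := by
  simp only [empirical]
  rw [lintegral_smul_measure, lintegral_finsetSum_measure]
  simp [lintegral_dirac' _ hf]

theorem toReal_rpow_half_sq (a : ℝ≥0∞) : ((a ^ (1 / 2 : ℝ)).toReal) ^ 2 = a.toReal := by
  rw [← ENNReal.toReal_pow, ← ENNReal.rpow_natCast, ← ENNReal.rpow_mul]
  norm_num

theorem toReal_average_enorm_sq {F : Type*} [NormedAddCommGroup F] {N : ℕ} (y : Fin N → F) :
    ((N : ℝ≥0∞)⁻¹ * ∑ j, ‖y j‖ₑ ^ (2 : ℝ)).toReal = (N : ℝ)⁻¹ * ∑ j, ‖y j‖ ^ 2 := by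
  rw [ENNReal.toReal_mul, ENNReal.toReal_sum fun j _ => by simp]
  simp

theorem M2_empirical_sq {d N : ℕ} [NeZero N] (x : Fin N → E d) :
    M2 (empirical x) ^ 2 = (N : ℝ)⁻¹ * ∑ j, ‖x j‖ ^ 2 := by
  rw [M2, momentNorm, toReal_rpow_half_sq, lintegral_empirical x (by fun_prop),
    toReal_average_enorm_sq]

theorem W2_dirac2_zero_le_M2 {d : ℕ} (μ : P2 d) : W2 μ (dirac2 0) ≤ M2 μ := by
  have := μ.2.1
  refine ENNReal.toReal_mono μ.2.2.ne ?_
  have hc : IsCoupling μ.1 (dirac2 0 : P2 d).1 (μ.1.map fun x => (x, (0 : E d))) := by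
    constructor
    · rw [Measure.map_map (by fun_prop) (by fun_prop)]
      exact Measure.map_id
    · rw [Measure.map_map (by fun_prop) (by fun_prop)]
      change μ.1.map (fun _ => (0 : E d)) = _
      simp [Measure.map_const, dirac2]
  refine (iInf₂_le _ hc).trans (le_of_eq ?_)
  rw [lintegral_map (by fun_prop) (by fun_prop)]
  simp [momentNorm]

theorem W2_empirical_sq_le {d N : ℕ} [NeZero N] (x y : Fin N → E d) :
    W2 (empirical x) (empirical y) ^ 2 ≤ (N : ℝ)⁻¹ * ∑ j, ‖x j - y j‖ ^ 2 := by
  have h : wassersteinDist 2 (empirical x).1 (empirical y).1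
      ≤ ((N : ℝ≥0∞)⁻¹ * ∑ j, ‖x j - y j‖ₑ ^ (2 : ℝ)) ^ (1 / 2 : ℝ) := by
    have hc : IsCoupling (empirical x).1 (empirical y).1
        ((N : ℝ≥0∞)⁻¹ • ∑ j, Measure.dirac (x j, y j)) := by
      constructor
      · rw [Measure.map_smul, Measure.map_finset_sum measurable_fst.aemeasurable]
        simp [empirical, Measure.map_dirac' measurable_fst]
      · rw [Measure.map_smul, Measure.map_finset_sum measurable_snd.aemeasurable]
        simp [empirical, Measure.map_dirac' measurable_snd]
    refine (iInf₂_le _ hc).trans (le_of_eq ?_)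
    rw [lintegral_smul_measure, lintegral_finsetSum_measure]
    simp_rw [lintegral_dirac' _ (show Measurable fun z : E d × E d => ‖z.1 - z.2‖ₑ ^ (2 : ℝ) by
      fun_prop)]
    rfl
  have hN : (N : ℝ≥0∞) ≠ 0 := by simp [NeZero.ne N]
  have hfin : ((N : ℝ≥0∞)⁻¹ * ∑ j, ‖x j - y j‖ₑ ^ (2 : ℝ)) ^ (1 / 2 : ℝ) ≠ ∞ := by
    refine ENNReal.rpow_ne_top_of_nonneg (by norm_num) (ENNReal.mul_ne_top (by simpa using hN) ?_)
    exact ENNReal.sum_ne_top.2 fun j _ => by simp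
  calc W2 (empirical x) (empirical y) ^ 2
      ≤ (((N : ℝ≥0∞)⁻¹ * ∑ j, ‖x j - y j‖ₑ ^ (2 : ℝ)) ^ (1 / 2 : ℝ)).toReal ^ 2 := by
        exact pow_le_pow_left₀ ENNReal.toReal_nonneg (ENNReal.toReal_mono hfin h) 2
    _ = _ := by rw [toReal_rpow_half_sq, toReal_average_enorm_sq]

/-- Linear growth of the diffusion coefficient. -/
theorem DiffusionLipschitz.hsNorm_sq_le {d m : ℕ} {σ : E d → P2 d → Matrix (Fin d) (Fin m) ℝ}
    {q₀ a₁ a₂ Lσ : ℝ} (hσ : DiffusionLipschitz σ q₀ a₁ a₂ Lσ) (x : E d) (μ : P2 d) :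
    hsNorm (σ x μ) ^ 2 ≤ 2 * Lσ * (‖x‖ ^ 2 + M2 μ ^ 2) + 2 * hsNorm (σ 0 (dirac2 0)) ^ 2 := by
  have h1 := hsNorm_sq_le_two_mul_add (σ x μ) (σ 0 (dirac2 0))
  have h2 := hσ.2.2 x 0 μ (dirac2 0)
  rw [sub_zero] at h2
  have h3 : W2 μ (dirac2 0) ^ 2 ≤ M2 μ ^ 2 :=
    pow_le_pow_left₀ ENNReal.toReal_nonneg (W2_dirac2_zero_le_M2 μ) 2
  have := mul_le_mul_of_nonneg_left h3 hσ.1.le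
  linarith

theorem tendsto_W2_empirical_sq {d N : ℕ} [NeZero N] {T : Type*} [TopologicalSpace T]
    {f : T → Fin N → E d} (hf : Continuous f) (t₀ : T) :
    Filter.Tendsto (fun t => W2 (empirical (f t)) (empirical (f t₀)) ^ 2) (nhds t₀) (nhds 0) := by
  refine squeeze_zero (fun _ => sq_nonneg _) (fun t => W2_empirical_sq_le _ _) ?_
  have : Continuous fun t => (N : ℝ)⁻¹ * ∑ j, ‖f t j - f t₀ j‖ ^ 2 := by fun_prop
  simpa using this.tendsto t₀

theorem DiffusionLipschitz.continuous_empirical {d m N : ℕ} [NeZero N]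
    {σ : E d → P2 d → Matrix (Fin d) (Fin m) ℝ}
    {q₀ a₁ a₂ Lσ : ℝ} (hσ : DiffusionLipschitz σ q₀ a₁ a₂ Lσ) (j : Fin N) :
    Continuous fun x : Fin N → E d => σ (x j) (empirical x) := by
  refine continuous_matrix fun i l => ?_
  rw [continuous_iff_continuousAt]
  intro x₀
  refine tendsto_iff_norm_sub_tendsto_zero.2 ?_
  have hlim : Filter.Tendsto (fun x : Fin N → E d => √(Lσ * (‖x j - x₀ j‖ ^ 2
      + W2 (empirical x) (empirical x₀) ^ 2))) (nhds x₀) (nhds 0) := by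
    have h1 : Continuous fun x : Fin N → E d => ‖x j - x₀ j‖ ^ 2 := by fun_prop
    have := (((h1.tendsto x₀).add (tendsto_W2_empirical_sq continuous_id x₀)).const_mul Lσ).sqrt
    simpa using this
  refine squeeze_zero (fun _ => norm_nonneg _) (fun x => ?_) hlim
  refine Real.le_sqrt_of_sq_le (le_trans ?_ (hσ.2.2 (x j) (x₀ j) (empirical x) (empirical x₀)))
  rw [hsNorm_sq, Real.norm_eq_abs, sq_abs]
  refine le_trans ?_ (Finset.single_le_sum
    (f := fun l => ∑ i, (σ (x j) (empirical x) - σ (x₀ j) (empirical x₀)) i l ^ 2)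
    (fun l _ => by positivity) (Finset.mem_univ l))
  exact Finset.single_le_sum
    (f := fun i => (σ (x j) (empirical x) - σ (x₀ j) (empirical x₀)) i l ^ 2)
    (fun l _ => by positivity) (Finset.mem_univ i)

/-- Stability of the implicit equation `x' - h b(x', μ) = y`: the solution depends continuously on
`(y, μ)` wherever it exists. -/
theorem ContractiveMonotone.norm_sub_sq_le {d m : ℕ} {b : E d → P2 d → E d}
    {σ : E d → P2 d → Matrix (Fin d) (Fin m) ℝ} {K₁ K₂ : ℝ} (hb : ContractiveMonotone b σ K₁ K₂)
    {h : ℝ} (hh : 0 ≤ h) (x y : E d) (μ ν : P2 d) :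
    ‖x - y‖ ^ 2 ≤ ‖(x - h • b x μ) - (y - h • b y ν)‖ ^ 2 + h * K₂ * W2 μ ν ^ 2 := by
  have h1 := hb.2.2 x y μ ν
  have h2 : 2 * inner ℝ (x - y) (b x μ - b y ν) ≤ K₂ * W2 μ ν ^ 2 := by
    have hK : 0 ≤ K₁ * ‖x - y‖ ^ 2 :=
      mul_nonneg (hb.2.1.trans hb.1.le) (sq_nonneg _)
    nlinarith [sq_nonneg (hsNorm (σ x μ - σ y ν))]
  have h3 : (x - h • b x μ) - (y - h • b y ν) = (x - y) - h • (b x μ - b y ν) := by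
    rw [smul_sub]; abel
  rw [h3, norm_sub_sq_real (x - y), inner_smul_right]
  nlinarith [sq_nonneg ‖h • (b x μ - b y ν)‖, mul_le_mul_of_nonneg_left h2 hh]

/-- A one-step energy estimate for the backward Euler step `x' = y + h b(x', μ)`. -/
theorem Coercive.norm_sq_le_of_implicit {d m : ℕ} {b : E d → P2 d → E d}
    {σ : E d → P2 d → Matrix (Fin d) (Fin m) ℝ} {q₀ a₁ a₂ qs C : ℝ}
    (hb : Coercive b σ q₀ a₁ a₂ qs C) (hq₀ : 1 ≤ q₀) {h : ℝ} (hh : 0 ≤ h) {x y : E d} {μ : P2 d}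
    (hxy : x = y + h • b x μ) :
    (1 + a₁ * h) * ‖x‖ ^ 2 ≤ ‖y‖ ^ 2 + h * a₂ * M2 μ ^ 2 + h * C := by
  obtain ⟨-, -, hqs, -, hco⟩ := hb
  have h1 := hco x μ
  have h2 : 0 ≤ (qs - 1) * hsNorm (σ x μ) ^ 2 := mul_nonneg (by linarith) (sq_nonneg _)
  have h3 : y = x - h • b x μ := eq_sub_of_add_eq hxy.symm
  rw [h3, norm_sub_sq_real, inner_smul_right]
  have h4 : 2 * inner ℝ x (b x μ) ≤ -a₁ * ‖x‖ ^ 2 + a₂ * M2 μ ^ 2 + C := by linarith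
  nlinarith [sq_nonneg ‖h • b x μ‖, mul_le_mul_of_nonneg_left h4 hh]

/-! ### Independence of the noise from the past -/

theorem indepFun_prodMk_right {Ω α β γ : Type*} [MeasurableSpace Ω] [MeasurableSpace α]
    [MeasurableSpace β] [MeasurableSpace γ] {P : Measure Ω} [IsProbabilityMeasure P]
    {Z : Ω → α} {Y : Ω → β} {Q : Ω → γ} (hZ : Measurable Z) (hY : Measurable Y)
    (hQ : Measurable Q) (h1 : IndepFun Z Y P) (h2 : IndepFun (fun ω => (Z ω, Y ω)) Q P) :
    IndepFun Z (fun ω => (Y ω, Q ω)) P := by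
  have h3 : IndepFun Y Q P := h2.comp measurable_snd measurable_id
  have : IsProbabilityMeasure (P.map Z) := Measure.isProbabilityMeasure_map hZ.aemeasurable
  have : IsProbabilityMeasure (P.map Y) := Measure.isProbabilityMeasure_map hY.aemeasurable
  have : IsProbabilityMeasure (P.map Q) := Measure.isProbabilityMeasure_map hQ.aemeasurable
  rw [indepFun_iff_map_prod_eq_prod_map_map hZ.aemeasurable (by fun_prop),
    h3.map_prod_eq_prod_map_map hY.aemeasurable hQ.aemeasurable]
  rw [← (measurePreserving_prodAssoc (P.map Z) (P.map Y) (P.map Q)).map_eq,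
    ← h1.map_prod_eq_prod_map_map hZ.aemeasurable hY.aemeasurable,
    ← h2.map_prod_eq_prod_map_map (by fun_prop) hQ.aemeasurable,
    Measure.map_map (by fun_prop) (by fun_prop)]
  rfl

theorem indepFun_pi_of_iIndepFun_prodMk {Ω α β ι : Type*} [MeasurableSpace Ω] [MeasurableSpace α]
    [MeasurableSpace β] [Fintype ι] {P : Measure Ω} [IsProbabilityMeasure P]
    {Z : ι → Ω → α} {Y : ι → Ω → β} (hZ : ∀ l, Measurable (Z l)) (hY : ∀ l, Measurable (Y l))
    (h1 : ∀ l, IndepFun (Z l) (Y l) P) (h2 : iIndepFun (fun l ω => (Z l ω, Y l ω)) P) :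
    IndepFun (fun ω l => Z l ω) (fun ω l => Y l ω) P := by
  have hpZ l : IsProbabilityMeasure (P.map (Z l)) :=
    Measure.isProbabilityMeasure_map (hZ l).aemeasurable
  have hpY l : IsProbabilityMeasure (P.map (Y l)) :=
    Measure.isProbabilityMeasure_map (hY l).aemeasurable
  have hiZ : iIndepFun Z P := h2.comp (fun _ => Prod.fst) fun _ => measurable_fst
  have hiY : iIndepFun Y P := h2.comp (fun _ => Prod.snd) fun _ => measurable_snd
  rw [indepFun_iff_map_prod_eq_prod_map_map (by fun_prop) (by fun_prop),
    hiZ.map_fun_eq_pi_map fun l => (hZ l).aemeasurable,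
    hiY.map_fun_eq_pi_map fun l => (hY l).aemeasurable,
    ← (measurePreserving_arrowProdEquivProdArrow α β ι _ _).map_eq]
  simp_rw [← fun l => (h1 l).map_prod_eq_prod_map_map (hZ l).aemeasurable (hY l).aemeasurable]
  rw [← h2.map_fun_eq_pi_map fun l => by fun_prop, Measure.map_map (by fun_prop) (by fun_prop)]
  rfl

theorem IsWiener.indepFun_increment {Ω : Type*} [MeasurableSpace Ω] {P : Measure Ω}
    [IsProbabilityMeasure P] {m : ℕ} {W : ℝ≥0 → Ω → E m} (hW : IsWiener W P) (T h : ℝ≥0) :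
    IndepFun (fun ω => W (T + h) ω - W T ω) (fun ω (t : Set.Iic T) => W t ω) P := by
  have hm := hW.measurable
  have key := indepFun_pi_of_iIndepFun_prodMk (P := P)
    (Z := fun (l : Fin m) ω => W (T + h) ω l - W T ω l)
    (Y := fun (l : Fin m) ω (t : Set.Iic T) => W t ω l) (by fun_prop) (by fun_prop)
    (fun l => ((hW.brownian l).toIsPreBrownianReal.indepFun_shift T).comp
      (measurable_pi_apply h) measurable_id)
    (hW.indep.comp (fun _ w => (w (T + h) - w T, fun t : Set.Iic T => w t)) (by fun_prop))
  exact key.comp (φ := fun z => (WithLp.toLp 2 z : E m))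
    (ψ := fun y (t : Set.Iic T) => (WithLp.toLp 2 fun l => y l t : E m)) (by fun_prop)
    (by fun_prop)

theorem IsWiener.map_increment {Ω : Type*} [MeasurableSpace Ω] {P : Measure Ω}
    [IsProbabilityMeasure P] {m : ℕ} {W : ℝ≥0 → Ω → E m} (hW : IsWiener W P) (T h : ℝ≥0) :
    P.map (fun ω => W (T + h) ω - W T ω)
      = (Measure.pi fun _ => gaussianReal 0 h).map (WithLp.toLp 2) := by
  have hm := hW.measurable
  have h1 : iIndepFun (fun (l : Fin m) ω => W (T + h) ω l - W T ω l) P :=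
    hW.indep.comp (fun _ w => w (T + h) - w T) (by fun_prop)
  have h2 := h1.map_fun_eq_pi_map fun l => by fun_prop
  simp_rw [fun l => ((hW.brownian l).toIsPreBrownianReal.shift T).hasLaw_eval h |>.map_eq] at h2
  rw [← h2, Measure.map_map (by fun_prop) (by fun_prop)]
  rfl

/-- The driving data of the particle system up to time `T`: the Wiener paths on `[0, T]` and the
initial values. -/
def past {Ω : Type*} {d m N : ℕ} (Wi : Fin N → ℝ≥0 → Ω → E m) (X₀i : Fin N → Ω → E d) (T : ℝ≥0)
    (ω : Ω) : Fin N → (Set.Iic T → E m) × E d :=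
  fun j => (fun t => Wi j t ω, X₀i j ω)

section

variable {Ω : Type*} [MeasurableSpace Ω] {d m N : ℕ} {P : Measure Ω}
  {W : ℝ≥0 → Ω → E m} {X₀ : Ω → E d} {Wi : Fin N → ℝ≥0 → Ω → E m} {X₀i : Fin N → Ω → E d}

theorem IsIIDCopies.measurable_past (hI : IsIIDCopies P W X₀ Wi X₀i) (T : ℝ≥0) :
    Measurable (past Wi X₀i T) := by
  have h1 := fun i => (hI.wiener i).measurable
  have h2 := hI.measurable
  unfold past
  fun_prop

/-- The increment of one Wiener process is independent of the past of the whole particle system: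
of its own past, of its own initial value and of all other particles. -/
theorem IsIIDCopies.indepFun_past [IsProbabilityMeasure P] (hI : IsIIDCopies P W X₀ Wi X₀i)
    (h0 : IndepFun X₀ (fun ω t => W t ω) P) (T h : ℝ≥0) (i : Fin N) :
    IndepFun (fun ω => Wi i (T + h) ω - Wi i T ω) (past Wi X₀i T) P := by
  have hm := fun i => (hI.wiener i).measurable
  have hm0 := hI.measurable
  have hown : IndepFun (fun ω t => Wi i t ω) (X₀i i) P :=
    indepFun_of_identDistrib_pair h0.symm (hI.identDistrib i).symm
  have h1 : IndepFun (fun ω => Wi i (T + h) ω - Wi i T ω)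
      (fun ω => ((fun t : Set.Iic T => Wi i t ω), X₀i i ω)) P :=
    indepFun_prodMk_right (by fun_prop) (by fun_prop) (by fun_prop)
      ((hI.wiener i).indepFun_increment T h)
      (hown.comp (φ := fun w => (w (T + h) - w T, fun t : Set.Iic T => w t)) (by fun_prop)
        measurable_id)
  have hothers := (hI.indep.indepFun_finset {i} {i}ᶜ disjoint_compl_right
    fun j => by fun_prop).comp
    (φ := fun q : ({i} : Finset (Fin N)) → (ℝ≥0 → E m) × E d =>
      ((q ⟨i, by simp⟩).1 (T + h) - (q ⟨i, by simp⟩).1 T,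
      ((fun t : Set.Iic T => (q ⟨i, by simp⟩).1 t), (q ⟨i, by simp⟩).2)))
    (by fun_prop) measurable_id
  have h2 := indepFun_prodMk_right (by fun_prop) (by fun_prop) (by fun_prop) h1 hothers
  refine (h2.comp (φ := id) (ψ := fun q j => if hj : j = i then q.1 else
    ((fun t : Set.Iic T => (q.2 ⟨j, by simp [hj]⟩).1 t), (q.2 ⟨j, by simp [hj]⟩).2))
    measurable_id ?_).congr .rfl (.of_forall fun ω => ?_)
  · refine measurable_pi_lambda _ fun j => ?_
    by_cases hj : j = i
    · simp only [hj, dite_true]; fun_prop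
    · simp only [hj, dite_false]; fun_prop
  · ext1 j
    by_cases hj : j = i
    · subst hj; simp [past]
    · simp [past, hj]

end

/-! ### Regularity of the implicit step and integration of the noise -/

theorem W2_empirical_sq_le_norm_sub_sq {d N : ℕ} [NeZero N] (x y : Fin N → E d) :
    W2 (empirical x) (empirical y) ^ 2 ≤ ‖x - y‖ ^ 2 := by
  refine (W2_empirical_sq_le x y).trans ?_
  have hN : (0 : ℝ) < N := by exact_mod_cast Nat.pos_of_neZero N
  rw [inv_mul_le_iff₀ hN]
  calc ∑ j, ‖x j - y j‖ ^ 2 ≤ ∑ _j : Fin N, ‖x - y‖ ^ 2 :=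
        Finset.sum_le_sum fun j _ => by gcongr; exact norm_le_pi_norm (x - y) j
    _ = _ := by simp

/-- A solution of the implicit equation `x' - h b(x', μ) = y` with `μ` an empirical measure is the
value of a globally defined continuous function of the data: on the set where a solution exists the
solution is Lipschitz, and Lipschitz maps into `ℝ^d` extend to the whole space. -/
theorem ContractiveMonotone.exists_continuous_solution {d m N : ℕ} [NeZero N]
    {b : E d → P2 d → E d} {σ : E d → P2 d → Matrix (Fin d) (Fin m) ℝ} {K₁ K₂ : ℝ}
    (hb : ContractiveMonotone b σ K₁ K₂) {h : ℝ} (hh : 0 ≤ h) :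
    ∃ G : E d × (Fin N → E d) → E d, Continuous G ∧
      ∀ x' t, x' - h • b x' (empirical t.2) = t.1 → G t = x' := by
  classical
  let S : Set (E d × (Fin N → E d)) := {t | ∃ x', x' - h • b x' (empirical t.2) = t.1}
  let f : E d × (Fin N → E d) → E d := fun t => if ht : t ∈ S then ht.choose else 0
  have hf : ∀ t ∈ S, f t - h • b (f t) (empirical t.2) = t.1 := fun t ht => by
    simp only [f, ht, dite_true]
    exact ht.choose_spec
  have hK := hb.2.1
  have hlip' : ∀ (x y : E d) (t u : E d × (Fin N → E d)), x - h • b x (empirical t.2) = t.1 →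
      y - h • b y (empirical u.2) = u.1 →
      ‖x - y‖ ≤ √(1 + h * K₂) * ‖t - u‖ := fun x y t u hx hy => by
    refine abs_le_of_sq_le_sq' ?_ (by positivity) |>.2
    rw [mul_pow, Real.sq_sqrt (by positivity)]
    have h1 := hb.norm_sub_sq_le hh x y (empirical t.2) (empirical u.2)
    rw [hx, hy] at h1
    have h2 := W2_empirical_sq_le_norm_sub_sq t.2 u.2
    have h3 : ‖t.1 - u.1‖ ^ 2 ≤ ‖t - u‖ ^ 2 := by gcongr; exact norm_fst_le (t - u)
    have h4 : ‖t.2 - u.2‖ ^ 2 ≤ ‖t - u‖ ^ 2 := by gcongr; exact norm_snd_le (t - u)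
    have h5 := mul_le_mul_of_nonneg_left (h2.trans h4) (mul_nonneg hh hK)
    linarith
  have hlip : LipschitzOnWith ⟨√(1 + h * K₂), Real.sqrt_nonneg _⟩ f S :=
    LipschitzOnWith.of_dist_le_mul fun t ht u hu => by
      rw [dist_eq_norm, dist_eq_norm]
      exact hlip' _ _ _ _ (hf t ht) (hf u hu)
  obtain ⟨G, hG, hGf⟩ := hlip.extend_finite_dimension
  refine ⟨G, hG.continuous, fun x' t hx' => ?_⟩
  have ht : t ∈ S := ⟨x', hx'⟩
  rw [← hGf ht, ← sub_eq_zero, ← norm_le_zero_iff]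
  simpa using hlip' _ _ _ _ (hf t ht) hx'

theorem continuous_hsNorm {d m : ℕ} : Continuous (hsNorm : Matrix (Fin d) (Fin m) ℝ → ℝ) :=
  Real.continuous_sqrt.comp (continuous_id.matrix_mul continuous_id.matrix_transpose).matrix_trace

theorem DiffusionLipschitz.continuous_add_mulE {d m N : ℕ} [NeZero N]
    {σ : E d → P2 d → Matrix (Fin d) (Fin m) ℝ}
    {q₀ a₁ a₂ Lσ : ℝ} (hσ : DiffusionLipschitz σ q₀ a₁ a₂ Lσ) (j : Fin N) :
    Continuous fun t : (Fin N → E d) × E m =>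
      t.1 j + mulE (σ (t.1 j) (empirical t.1)) t.2 := by
  have hc := hσ.continuous_empirical j
  simp_rw [mulE_eq_sum_col]
  refine ((continuous_apply j).comp continuous_fst).add (continuous_finsetSum _ fun l _ => ?_)
  have hz : Continuous fun t : (Fin N → E d) × E m => t.2 l := by fun_prop
  refine hz.smul ((PiLp.continuous_toLp 2 _).comp ?_)
  exact continuous_pi fun i => (hc.comp continuous_fst).matrix_elem i l

/-- Hypercontractive bound for a Gaussian perturbation, with a real exponent `p ≤ n`. -/
theorem lintegral_add_mulE_rpow_le {d m : ℕ} (h : ℝ≥0) {n : ℕ} {p : ℝ} (hp : 0 < p) (hpn : p ≤ n)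
    (x : E d) (B : Matrix (Fin d) (Fin m) ℝ) :
    ∫⁻ z, ENNReal.ofReal (‖x + mulE B z‖ ^ 2) ^ p
        ∂((Measure.pi fun _ : Fin m => gaussianReal 0 h).map (WithLp.toLp 2))
      ≤ ENNReal.ofReal (‖x‖ ^ 2 + (2 * n - 1) * h * hsNorm B ^ 2) ^ p := by
  have hn : 1 ≤ n := by
    have : (0 : ℝ) < n := hp.trans_le hpn
    exact_mod_cast this
  have hn0 : (0 : ℝ) < n := by exact_mod_cast hn
  have hn' : (1 : ℝ) ≤ n := by exact_mod_cast hn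
  have hmul : Measurable fun z : E m => mulE B z := by
    simp_rw [mulE_eq_sum_col]; fun_prop
  rw [lintegral_map (by fun_prop) (by fun_prop)]
  set ν := Measure.pi fun _ : Fin m => gaussianReal 0 h
  set R := ‖x‖ ^ 2 + (2 * n - 1) * h * hsNorm B ^ 2
  have hR : 0 ≤ R := by
    have : (0 : ℝ) ≤ 2 * n - 1 := by linarith
    positivity
  set Q : (Fin m → ℝ) → ℝ := fun z => ‖x + mulE B (WithLp.toLp 2 z)‖ ^ 2 with hQ
  have hQm : Measurable Q := by fun_prop
  have hQn : ∀ z, ‖Q z‖ₑ = ENNReal.ofReal (Q z) := fun z => by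
    rw [Real.enorm_eq_ofReal (by positivity)]
  have h1 : ∫⁻ z, ENNReal.ofReal (Q z) ^ (n : ℝ) ∂ν ≤ ENNReal.ofReal R ^ (n : ℝ) := by
    have := lintegral_pi_gaussianReal_le h hn (fun l => (WithLp.toLp 2 fun i => B i l : E d)) x
      le_rfl
    simp only [add_zero, sum_norm_col_sq] at this
    rw [ENNReal.rpow_natCast, ← ENNReal.ofReal_pow hR]
    refine le_trans (le_of_eq (lintegral_congr fun z => ?_)) this
    rw [ENNReal.rpow_natCast, ← ENNReal.ofReal_pow (by positivity), hQ]
    simp only [mulE_eq_sum_col]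
  have h2 := eLpNorm_le_eLpNorm_of_exponent_le (μ := ν) (f := Q)
    (ENNReal.ofReal_le_ofReal hpn) hQm.aestronglyMeasurable
  rw [eLpNorm_eq_lintegral_rpow_enorm_toReal (by simpa using hp) (by simp),
    eLpNorm_eq_lintegral_rpow_enorm_toReal (by simpa using (zero_lt_one.trans_le hn).ne') (by simp),
    ENNReal.toReal_ofReal hp.le, ENNReal.toReal_ofReal hn0.le] at h2
  simp only [hQn] at h2
  calc ∫⁻ z, ENNReal.ofReal (Q z) ^ p ∂ν
      = ((∫⁻ z, ENNReal.ofReal (Q z) ^ p ∂ν) ^ (1 / p)) ^ p := by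
        rw [← ENNReal.rpow_mul, one_div_mul_cancel hp.ne', ENNReal.rpow_one]
    _ ≤ ((ENNReal.ofReal R ^ (n : ℝ)) ^ (1 / (n : ℝ))) ^ p := by
        gcongr
        exact h2.trans (ENNReal.rpow_le_rpow h1 (by positivity))
    _ = _ := by rw [← ENNReal.rpow_mul _ (n : ℝ), mul_one_div_cancel hn0.ne', ENNReal.rpow_one]

section

variable {Ω : Type*} {d m N : ℕ}
  {Wi : Fin N → ℝ≥0 → Ω → E m} {X₀i : Fin N → Ω → E d}

theorem comap_past_mono {S T : ℝ≥0} (hST : S ≤ T) :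
    MeasurableSpace.comap (past Wi X₀i S) inferInstance
      ≤ MeasurableSpace.comap (past Wi X₀i T) inferInstance := by
  have h : past Wi X₀i S = (fun q j => ((fun t : Set.Iic S =>
      (q j).1 ⟨t, Set.mem_Iic.2 ((Set.mem_Iic.1 t.2).trans hST)⟩), (q j).2)) ∘ past Wi X₀i T := rfl
  rw [h, ← MeasurableSpace.comap_comp]
  refine MeasurableSpace.comap_mono ?_
  exact Measurable.comap_le (by fun_prop)

theorem measurable_comap_past_wiener (i : Fin N) {t T : ℝ≥0} (ht : t ≤ T) :
    Measurable[MeasurableSpace.comap (past Wi X₀i T) inferInstance] (Wi i t) := by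
  have h : Wi i t = (fun q : Fin N → (Set.Iic T → E m) × E d => (q i).1 ⟨t, ht⟩)
    ∘ past Wi X₀i T := rfl
  rw [h]
  exact Measurable.comp (by fun_prop) (comap_measurable _)

theorem measurable_comap_past_init (i : Fin N) (T : ℝ≥0) :
    Measurable[MeasurableSpace.comap (past Wi X₀i T) inferInstance] (X₀i i) := by
  have h : X₀i i = (fun q : Fin N → (Set.Iic T → E m) × E d => (q i).2)
    ∘ past Wi X₀i T := rfl
  rw [h]
  exact Measurable.comp (by fun_prop) (comap_measurable _)

theorem aestronglyMeasurable_pi {F : Type*} [NormedAddCommGroup F] [MeasurableSpace F]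
    [BorelSpace F] [SecondCountableTopology F] {mΩ m₀ : MeasurableSpace Ω} {P : Measure[mΩ] Ω}
    {Y : Fin N → Ω → F} (hY : ∀ j, AEStronglyMeasurable[m₀] (Y j) P) :
    AEStronglyMeasurable[m₀] (fun ω j => Y j ω) P := by
  choose g hg hYg using hY
  refine ⟨fun ω j => g j ω, (measurable_pi_lambda _ fun j => (hg j).measurable).stronglyMeasurable,
    ?_⟩
  filter_upwards [ae_all_iff.2 hYg] with ω hω
  exact funext hω

variable [mΩ : MeasurableSpace Ω] {P : Measure Ω} {W : ℝ≥0 → Ω → E m} {X₀ : Ω → E d} [NeZero N]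
  {b : E d → P2 d → E d} {σ : E d → P2 d → Matrix (Fin d) (Fin m) ℝ}
  {K₁ K₂ q₀ a₁ a₂ Lσ : ℝ} {h : ℝ≥0} {X : ℕ → Fin N → Ω → E d}

/-- The iterates of the scheme are, up to null sets, determined by the past. -/
theorem IsBackwardEuler.aestronglyMeasurable_comap_past (hX : IsBackwardEuler P b σ Wi X₀i h X)
    (hb : ContractiveMonotone b σ K₁ K₂) (hσ : DiffusionLipschitz σ q₀ a₁ a₂ Lσ)
    (k : ℕ) (i : Fin N) :
    AEStronglyMeasurable[MeasurableSpace.comap (past Wi X₀i (k * h)) inferInstance] (X k i) P := by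
  induction k generalizing i with
  | zero =>
    exact ⟨X₀i i, (measurable_comap_past_init i _).stronglyMeasurable, hX.init i⟩
  | succ k ih =>
    have hle : (k : ℝ≥0) * h ≤ ((k + 1 : ℕ) : ℝ≥0) * h := by gcongr; simp
    obtain ⟨G, hG, hGs⟩ := hb.exists_continuous_solution (N := N) h.coe_nonneg
    have h1 : ∀ j, AEStronglyMeasurable[MeasurableSpace.comap
        (past Wi X₀i (((k + 1 : ℕ) : ℝ≥0) * h)) inferInstance] (X k j) P :=
      fun j => (ih j).mono (comap_past_mono hle)
    have h2 : AEStronglyMeasurable[MeasurableSpace.comap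
        (past Wi X₀i (((k + 1 : ℕ) : ℝ≥0) * h)) inferInstance]
        (fun ω => Wi i (((k + 1 : ℕ) : ℝ≥0) * h) ω - Wi i ((k : ℝ≥0) * h) ω) P :=
      (Measurable.sub (measurable_comap_past_wiener i le_rfl)
        (measurable_comap_past_wiener i hle)).stronglyMeasurable.aestronglyMeasurable
    have h3 := aestronglyMeasurable_pi h1
    have hcont : Continuous fun t : (Fin N → E d) × E m =>
        G (t.1 i + mulE (σ (t.1 i) (empirical t.1)) t.2, t.1) :=
      hG.comp ((hσ.continuous_add_mulE i).prodMk continuous_fst)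
    refine (hcont.comp_aestronglyMeasurable (h3.prodMk h2)).congr ?_
    filter_upwards [hX.step k i] with ω hω
    refine hGs _ _ ?_
    simp only
    nth_rewrite 1 [hω]
    abel

/-- Bound in `L^p` for the squared norm of the explicit part of one step of the scheme. The noise
increment is independent of the current state, so it can be integrated out first. -/
theorem IsBackwardEuler.eLpNorm_explicit_le [IsProbabilityMeasure P]
    (hX : IsBackwardEuler P b σ Wi X₀i h X) (hI : IsIIDCopies P W X₀ Wi X₀i)
    (h0 : IndepFun X₀ (fun ω t => W t ω) P)
    (hb : ContractiveMonotone b σ K₁ K₂) (hσ : DiffusionLipschitz σ q₀ a₁ a₂ Lσ)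
    {p : ℝ} (hp : 0 < p) {n : ℕ} (hpn : p ≤ n) (k : ℕ) (i : Fin N) :
    eLpNorm (fun ω => ‖X k i ω + mulE (σ (X k i ω) (empirical fun j => X k j ω))
        (Wi i (((k + 1 : ℕ) : ℝ≥0) * h) ω - Wi i ((k : ℝ≥0) * h) ω)‖ ^ 2) (ENNReal.ofReal p) P
      ≤ eLpNorm (fun ω => ‖X k i ω‖ ^ 2 + (2 * n - 1) * h
        * hsNorm (σ (X k i ω) (empirical fun j => X k j ω)) ^ 2) (ENNReal.ofReal p) P := by
  have hWm := (hI.wiener i).measurable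
  have hpast := (hI.measurable_past ((k : ℝ≥0) * h)).comap_le
  have hn1 : (0 : ℝ) ≤ 2 * n - 1 := by
    have h1 : (0 : ℝ) < n := hp.trans_le hpn
    have h2 : (1 : ℝ) ≤ n := by exact_mod_cast (by exact_mod_cast h1 : 0 < n)
    linarith
  rw [show ((k + 1 : ℕ) : ℝ≥0) * h = k * h + h by push_cast; ring]
  set Z : Ω → E m := fun ω => Wi i (k * h + h) ω - Wi i (k * h) ω
  have hZ : Measurable Z := by fun_prop
  set Y : Ω → Fin N → E d := fun ω j => X k j ω
  have hY := aestronglyMeasurable_pi (hX.aestronglyMeasurable_comap_past hb hσ k)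
  have hYm : AEMeasurable Y P := (hY.mono hpast).aemeasurable
  have hind : IndepFun Z Y P := by
    obtain ⟨Y', hY', hYY'⟩ := hY
    refine IndepFun.congr (g := Y') ?_ .rfl hYY'.symm
    exact indep_of_indep_of_le_right (hI.indepFun_past h0 (k * h) h i) hY'.measurable.comap_le
  have hlaw : P.map (fun ω => (Y ω, Z ω)) = (P.map Y).prod
      ((Measure.pi fun _ : Fin m => gaussianReal 0 h).map (WithLp.toLp 2)) := by
    rw [hind.symm.map_prod_eq_prod_map_map hYm hZ.aemeasurable,
      (hI.wiener i).map_increment]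
  have hcont := hσ.continuous_add_mulE i
  rw [eLpNorm_eq_lintegral_rpow_enorm_toReal (by simpa using hp) (by simp),
    eLpNorm_eq_lintegral_rpow_enorm_toReal (by simpa using hp) (by simp),
    ENNReal.toReal_ofReal hp.le]
  refine ENNReal.rpow_le_rpow ?_ (by positivity)
  calc _ = ∫⁻ t, ENNReal.ofReal (‖t.1 i + mulE (σ (t.1 i) (empirical t.1)) t.2‖ ^ 2) ^ p
        ∂(P.map fun ω => (Y ω, Z ω)) := by
        rw [lintegral_map' (Measurable.aemeasurable (by
          have := hcont.measurable
          fun_prop)) (by fun_prop)]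
        refine lintegral_congr fun ω => ?_
        rw [Real.enorm_eq_ofReal (by positivity)]
    _ = ∫⁻ y, ∫⁻ z, ENNReal.ofReal (‖y i + mulE (σ (y i) (empirical y)) z‖ ^ 2) ^ p
        ∂((Measure.pi fun _ : Fin m => gaussianReal 0 h).map (WithLp.toLp 2)) ∂(P.map Y) := by
        have : IsProbabilityMeasure ((Measure.pi fun _ : Fin m => gaussianReal 0 h).map
          (WithLp.toLp 2 : _ → E m)) := Measure.isProbabilityMeasure_map (by fun_prop)
        rw [hlaw, lintegral_prod _ (Measurable.aemeasurable (by
          have := hcont.measurable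
          fun_prop))]
    _ ≤ ∫⁻ y, ENNReal.ofReal (‖y i‖ ^ 2 + (2 * n - 1) * h
        * hsNorm (σ (y i) (empirical y)) ^ 2) ^ p ∂(P.map Y) :=
        lintegral_mono fun y => lintegral_add_mulE_rpow_le h hp hpn _ _
    _ = _ := by
        have hs := hσ.continuous_empirical i
        have hc : Continuous fun y : Fin N → E d => ‖y i‖ ^ 2 + (2 * n - 1) * h
            * hsNorm (σ (y i) (empirical y)) ^ 2 :=
          ((continuous_apply i).norm.pow 2).add
            (continuous_const.mul ((continuous_hsNorm.comp hs).pow 2))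
        rw [lintegral_map' (hc.measurable.ennreal_ofReal.pow_const p).aemeasurable hYm]
        refine lintegral_congr fun ω => ?_
        rw [Real.enorm_eq_ofReal (by positivity)]

end

/-! ### Uniform moment bounds -/

theorem eLpNorm_affine_le {Ω : Type*} [MeasurableSpace Ω] {P : Measure Ω} [IsProbabilityMeasure P]
    {q v : ℝ≥0∞} (hq : 1 ≤ q) {f g : Ω → ℝ} (hf : AEStronglyMeasurable f P)
    (hg : AEStronglyMeasurable g P) (hfv : eLpNorm f q P ≤ v) (hgv : eLpNorm g q P ≤ v)
    {A B D : ℝ} (hA : 0 ≤ A) (hB : 0 ≤ B) (hD : 0 ≤ D) :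
    eLpNorm (fun ω => A * f ω + B * g ω + D) q P
      ≤ ENNReal.ofReal (A + B) * v + ENNReal.ofReal D := by
  have hq0 : q ≠ 0 := (zero_lt_one.trans_le hq).ne'
  calc eLpNorm (fun ω => A * f ω + B * g ω + D) q P
      ≤ eLpNorm (A • f) q P + eLpNorm (B • g) q P + eLpNorm (fun _ : Ω => D) q P :=
        (eLpNorm_add_le ((hf.const_mul A).add (hg.const_mul B)) (by fun_prop) hq).trans
          (by gcongr; exact eLpNorm_add_le (hf.const_mul A) (hg.const_mul B) hq)
    _ ≤ ENNReal.ofReal A * v + ENNReal.ofReal B * v + ENNReal.ofReal D := by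
        rw [eLpNorm_const_smul, eLpNorm_const_smul, eLpNorm_const _ hq0 (NeZero.ne P),
          Real.enorm_eq_ofReal hA, Real.enorm_eq_ofReal hB, Real.enorm_eq_ofReal hD]
        simp only [measure_univ, ENNReal.one_rpow, mul_one]
        gcongr
    _ = _ := by rw [ENNReal.ofReal_add hA hB, add_mul]

theorem eLpNorm_average_le {Ω : Type*} [MeasurableSpace Ω] {P : Measure Ω}
    {q v : ℝ≥0∞} (hq : 1 ≤ q) {N : ℕ} [NeZero N] {f : Fin N → Ω → ℝ}
    (hf : ∀ j, AEStronglyMeasurable (f j) P) (hfv : ∀ j, eLpNorm (f j) q P ≤ v) :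
    eLpNorm (fun ω => (N : ℝ)⁻¹ * ∑ j, f j ω) q P ≤ v := by
  have hN : (N : ℝ≥0∞) ≠ 0 := by simp [NeZero.ne N]
  have h1 : (fun ω => (N : ℝ)⁻¹ * ∑ j, f j ω) = (N : ℝ)⁻¹ • ∑ j, f j := by
    ext ω; simp
  have h2 : ‖(N : ℝ)⁻¹‖ₑ = (N : ℝ≥0∞)⁻¹ := by
    rw [Real.enorm_eq_ofReal (by positivity), ENNReal.ofReal_inv_of_pos
      (by exact_mod_cast Nat.pos_of_neZero N), ENNReal.ofReal_natCast]
  rw [h1, eLpNorm_const_smul, h2]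
  calc (N : ℝ≥0∞)⁻¹ * eLpNorm (∑ j, f j) q P ≤ (N : ℝ≥0∞)⁻¹ * ∑ _j : Fin N, v := by
        gcongr
        exact (eLpNorm_sum_le (fun j _ => hf j) hq).trans (Finset.sum_le_sum fun j _ => hfv j)
    _ = v := by
        rw [Finset.sum_const, Finset.card_univ, Fintype.card_fin, nsmul_eq_mul, ← mul_assoc,
          ENNReal.inv_mul_cancel hN (by simp), one_mul]

section

variable {Ω : Type*} [MeasurableSpace Ω] {d m N : ℕ} [NeZero N] {P : Measure Ω}
  [IsProbabilityMeasure P] {W : ℝ≥0 → Ω → E m} {X₀ : Ω → E d} {Wi : Fin N → ℝ≥0 → Ω → E m}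
  {X₀i : Fin N → Ω → E d} {b : E d → P2 d → E d} {σ : E d → P2 d → Matrix (Fin d) (Fin m) ℝ}
  {K₁ K₂ q₀ a₁ a₂ qs C Lσ : ℝ} {h : ℝ≥0} {X : ℕ → Fin N → Ω → E d}

/-- One step of the moment recursion for the scheme. The growth factor of the explicit part
exceeds one by `h (4 (2n - 1) L_σ + a₂)`, where one half of `4 (2n - 1) L_σ` comes from the particle
itself and the other half from the empirical measure. -/
theorem IsBackwardEuler.eLpNorm_succ_le
    (hX : IsBackwardEuler P b σ Wi X₀i h X) (hI : IsIIDCopies P W X₀ Wi X₀i)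
    (h0 : IndepFun X₀ (fun ω t => W t ω) P)
    (hb : ContractiveMonotone b σ K₁ K₂) (hc : Coercive b σ q₀ a₁ a₂ qs C) (hq₀ : 1 ≤ q₀)
    (hσ : DiffusionLipschitz σ q₀ a₁ a₂ Lσ)
    {p : ℝ} (hp : 1 ≤ p) {n : ℕ} (hpn : p ≤ n) (k : ℕ) {v : ℝ≥0∞}
    (hv : ∀ j, eLpNorm (fun ω => ‖X k j ω‖ ^ 2) (ENNReal.ofReal p) P ≤ v) (i : Fin N) :
    ENNReal.ofReal (1 + a₁ * h) * eLpNorm (fun ω => ‖X (k + 1) i ω‖ ^ 2) (ENNReal.ofReal p) P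
      ≤ ENNReal.ofReal (1 + (4 * (2 * n - 1) * Lσ + a₂) * h) * v
        + ENNReal.ofReal (h * (C + 2 * (2 * n - 1) * hsNorm (σ 0 (dirac2 0)) ^ 2)) := by
  have hn1 : (0 : ℝ) ≤ 2 * n - 1 := by linarith
  have ha₂ : 0 ≤ a₂ := hc.2.1
  have ha₁ : 0 ≤ a₁ := ha₂.trans hc.1.le
  have hC : 0 ≤ C := hc.2.2.2.1
  have hL : 0 ≤ Lσ := hσ.1.le
  have hq : 1 ≤ ENNReal.ofReal p := ENNReal.one_le_ofReal.2 hp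
  have hWm := (hI.wiener i).measurable
  have hXm : ∀ j, AEStronglyMeasurable (X k j) P := fun j =>
    (hX.aestronglyMeasurable_comap_past hb hσ k j).mono (hI.measurable_past _).comap_le
  have hYm : AEStronglyMeasurable (fun ω j => X k j ω) P := aestronglyMeasurable_pi hXm
  have hFm : ∀ j, AEStronglyMeasurable (fun ω => ‖X k j ω‖ ^ 2) P := fun j => (hXm j).norm.pow 2
  set s₀ := hsNorm (σ 0 (dirac2 0)) ^ 2
  have hs₀ : 0 ≤ s₀ := sq_nonneg _
  set M : Ω → ℝ := fun ω => (N : ℝ)⁻¹ * ∑ j, ‖X k j ω‖ ^ 2 with hM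
  have hM2 : ∀ ω, M2 (empirical fun j => X k j ω) ^ 2 = M ω := fun ω => M2_empirical_sq _
  have hMm : AEStronglyMeasurable M P :=
    (Finset.aestronglyMeasurable_fun_sum _ fun j _ => hFm j).const_mul _
  have hMv : eLpNorm M (ENNReal.ofReal p) P ≤ v := eLpNorm_average_le hq hFm hv
  set g : Ω → ℝ := fun ω => ‖X k i ω + mulE (σ (X k i ω) (empirical fun j => X k j ω))
        (Wi i (((k + 1 : ℕ) : ℝ≥0) * h) ω - Wi i ((k : ℝ≥0) * h) ω)‖ ^ 2 with hg
  have hgm : AEStronglyMeasurable g P := by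
    have hZ : Measurable fun ω => Wi i (((k + 1 : ℕ) : ℝ≥0) * h) ω - Wi i ((k : ℝ≥0) * h) ω := by
      fun_prop
    exact (((hσ.continuous_add_mulE i).comp_aestronglyMeasurable
      (hYm.prodMk hZ.aestronglyMeasurable)).norm.pow 2)
  have hgv : eLpNorm g (ENNReal.ofReal p) P
      ≤ ENNReal.ofReal ((1 + (2 * n - 1) * h * (2 * Lσ)) + (2 * n - 1) * h * (2 * Lσ)) * v
        + ENNReal.ofReal ((2 * n - 1) * h * (2 * s₀)) := by
    refine (hX.eLpNorm_explicit_le hI h0 hb hσ (by linarith) hpn k i).trans ?_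
    refine le_trans (eLpNorm_mono_real fun ω => ?_) (eLpNorm_affine_le hq (hFm i) hMm (hv i) hMv
      (A := 1 + (2 * n - 1) * h * (2 * Lσ)) (B := (2 * n - 1) * h * (2 * Lσ))
      (D := (2 * n - 1) * h * (2 * s₀)) (by positivity) (by positivity) (by positivity))
    rw [Real.norm_of_nonneg (by positivity)]
    have h1 := hσ.hsNorm_sq_le (X k i ω) (empirical fun j => X k j ω)
    rw [hM2] at h1
    have h2 := mul_le_mul_of_nonneg_left h1 (mul_nonneg hn1 h.coe_nonneg)
    linarith
  calc ENNReal.ofReal (1 + a₁ * h) * eLpNorm (fun ω => ‖X (k + 1) i ω‖ ^ 2) (ENNReal.ofReal p) P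
      = eLpNorm ((1 + a₁ * (h : ℝ)) • fun ω => ‖X (k + 1) i ω‖ ^ 2) (ENNReal.ofReal p) P := by
        rw [eLpNorm_const_smul, Real.enorm_eq_ofReal (by positivity)]
    -- The summand with coefficient zero fits the shape of `eLpNorm_affine_le`.
    _ ≤ eLpNorm (g + fun ω => h * a₂ * M ω + 0 * M ω + h * C) (ENNReal.ofReal p) P := by
        refine eLpNorm_mono_ae_real ?_
        filter_upwards [hX.step k i] with ω hω
        have h1 := hc.norm_sq_le_of_implicit hq₀ h.coe_nonneg (hω.trans (add_right_comm _ _ _))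
        rw [hM2] at h1
        simp only [Pi.smul_apply, smul_eq_mul, Pi.add_apply, hg]
        rw [Real.norm_of_nonneg (by positivity)]
        linarith
    _ ≤ eLpNorm g (ENNReal.ofReal p) P
        + eLpNorm (fun ω => h * a₂ * M ω + 0 * M ω + h * C) (ENNReal.ofReal p) P :=
        eLpNorm_add_le hgm (((hMm.const_mul _).add (hMm.const_mul _)).add (by fun_prop)) hq
    _ ≤ (ENNReal.ofReal ((1 + (2 * n - 1) * h * (2 * Lσ)) + (2 * n - 1) * h * (2 * Lσ)) * v
        + ENNReal.ofReal ((2 * n - 1) * h * (2 * s₀)))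
        + (ENNReal.ofReal (h * a₂ + 0) * v + ENNReal.ofReal (h * C)) :=
        add_le_add hgv (eLpNorm_affine_le hq hMm hMm hMv hMv (by positivity) le_rfl
          (by positivity))
    _ = _ := by
        rw [add_add_add_comm, ← add_mul, ← ENNReal.ofReal_add (by positivity) (by positivity),
          ← ENNReal.ofReal_add (by positivity) (by positivity)]
        congr 3 <;> ring

/-- The `L^p` norms of the squared iterates exceed those of the initial values by at most a
constant, uniformly in the step size, the number of steps and the number of particles. -/
theorem IsBackwardEuler.eLpNorm_le
    (hX : IsBackwardEuler P b σ Wi X₀i h X) (hI : IsIIDCopies P W X₀ Wi X₀i)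
    (h0 : IndepFun X₀ (fun ω t => W t ω) P)
    (hb : ContractiveMonotone b σ K₁ K₂) (hc : Coercive b σ q₀ a₁ a₂ qs C) (hq₀ : 1 ≤ q₀)
    (hσ : DiffusionLipschitz σ q₀ a₁ a₂ Lσ)
    {p : ℝ} (hp : 1 ≤ p) {n : ℕ} (hpn : p ≤ n) (hα : 4 * (2 * n - 1) * Lσ + a₂ < a₁) {v : ℝ≥0∞}
    (hv : ∀ j, eLpNorm (fun ω => ‖X 0 j ω‖ ^ 2) (ENNReal.ofReal p) P ≤ v) (k : ℕ) (i : Fin N) :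
    eLpNorm (fun ω => ‖X k i ω‖ ^ 2) (ENNReal.ofReal p) P
      ≤ v + ENNReal.ofReal ((C + 2 * (2 * n - 1) * hsNorm (σ 0 (dirac2 0)) ^ 2)
        / (a₁ - (4 * (2 * n - 1) * Lσ + a₂))) := by
  have hn1 : (0 : ℝ) ≤ 2 * n - 1 := by linarith
  have ha₂ : 0 ≤ a₂ := hc.2.1
  have ha₁ : 0 ≤ a₁ := ha₂.trans hc.1.le
  have hC : 0 ≤ C := hc.2.2.2.1
  have hL : 0 ≤ Lσ := hσ.1.le
  induction k generalizing i with
  | zero => exact (hv i).trans le_self_add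
  | succ k ih =>
    have hstep := hX.eLpNorm_succ_le hI h0 hb hc hq₀ hσ hp hpn k ih i
    set C' := C + 2 * (2 * n - 1) * hsNorm (σ 0 (dirac2 0)) ^ 2
    have hC' : 0 ≤ C' := by positivity
    set α := 4 * (2 * n - 1) * Lσ + a₂
    have hα0 : 0 ≤ α := by positivity
    have hpos : 0 < a₁ - α := sub_pos.2 hα
    have hfac : 0 < 1 + a₁ * (h : ℝ) := by positivity
    refine (ENNReal.mul_le_mul_iff_right (a := ENNReal.ofReal (1 + a₁ * h))
      (by simpa using hfac) (by simp)).1 (hstep.trans ?_)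
    rw [mul_add (ENNReal.ofReal (1 + α * h)), mul_add (ENNReal.ofReal (1 + a₁ * h)), add_assoc,
      ← ENNReal.ofReal_mul (by positivity), ← ENNReal.ofReal_mul (by positivity),
      ← ENNReal.ofReal_add (by positivity) (by positivity)]
    -- The additive constant is the fixed point of the affine recursion.
    have hfix : (1 + α * h) * (C' / (a₁ - α)) + h * C' = (1 + a₁ * h) * (C' / (a₁ - α)) := by
      field_simp
      ring
    rw [hfix]
    gcongr

end

theorem eLpNorm_norm_sq_rpow {Ω F : Type*} [MeasurableSpace Ω] [NormedAddCommGroup F]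
    {P : Measure Ω} (f : Ω → F) {p : ℝ} (hp : 0 < p) :
    eLpNorm (fun ω => ‖f ω‖ ^ 2) (ENNReal.ofReal p) P ^ p = ∫⁻ ω, ‖f ω‖ₑ ^ (2 * p) ∂P := by
  rw [eLpNorm_eq_lintegral_rpow_enorm_toReal (by simpa using hp) (by simp),
    ENNReal.toReal_ofReal hp.le, ← ENNReal.rpow_mul, one_div_mul_cancel hp.ne', ENNReal.rpow_one]
  refine lintegral_congr fun ω => ?_
  rw [ENNReal.rpow_mul, enorm_pow, enorm_norm]
  norm_num

theorem rpow_two_mul_le_one_add_rpow_four_mul (t : ℝ≥0∞) {p : ℝ} (hp : 0 ≤ p) :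
    t ^ (2 * p) ≤ 1 + t ^ (4 * p) := by
  rcases le_total t 1 with ht | ht
  · exact (ENNReal.rpow_le_one ht (by linarith)).trans le_self_add
  · exact (ENNReal.rpow_le_rpow_of_exponent_le ht (by linarith)).trans le_add_self

end MVSDE

theorem mainTheorem10 {d m : ℕ}
    (b : E d → P2 d → E d) (σ : E d → P2 d → Matrix (Fin d) (Fin m) ℝ)
    (K₁ K₂ L₁ κ L₂ q₀ a₁ a₂ qs C Lσ h₀ p : ℝ)
    (hmono : ContractiveMonotone b σ K₁ K₂)
    (hpoly : PolyGrowthLipschitz b L₁ κ)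
    (hL₂ : 0 < L₂) (hb₀ : ‖b 0 (dirac2 0)‖ ≤ L₂) (hq₀ : 20 ≤ q₀)
    (hcoer : Coercive b σ q₀ a₁ a₂ qs C)
    (hσ : DiffusionLipschitz σ q₀ a₁ a₂ Lσ)
    (hh₀ : 0 < h₀) (hp : 1 ≤ p) (hp' : p < (⌊q₀ / 2⌋ : ℝ)) :
    ∃ K₉ : ℝ, 0 < K₉ ∧
      ∀ (Ω : Type*) [MeasurableSpace Ω] (P : Measure Ω) [IsProbabilityMeasure P]
        (W : ℝ≥0 → Ω → E m) (X₀ : Ω → E d),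
        IsWiener W P → Measurable X₀ → IndepFun X₀ (fun ω t => W t ω) P →
        (∫⁻ ω, ‖X₀ ω‖ₑ ^ (2 * q₀) ∂P) < ∞ →
        ∀ (N : ℕ) [NeZero N] (Wi : Fin N → ℝ≥0 → Ω → E m) (X₀i : Fin N → Ω → E d),
          IsIIDCopies P W X₀ Wi X₀i →
          ∀ h : ℝ≥0, 0 < h → (h : ℝ) ≤ stepBound K₁ K₂ h₀ a₁ a₂ p →
            ∀ X : ℕ → Fin N → Ω → E d, IsBackwardEuler P b σ Wi X₀i h X →
              ∀ k : ℕ,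
                (⨆ j, ∫⁻ ω, ‖X k j ω‖ₑ ^ (2 * p) ∂P)
                    ≤ ENNReal.ofReal K₉ * ⨆ j, ∫⁻ ω, (1 + ‖X₀i j ω‖ₑ ^ (4 * p)) ∂P ∧
                ENNReal.ofReal K₉ * (⨆ j, ∫⁻ ω, (1 + ‖X₀i j ω‖ₑ ^ (4 * p)) ∂P)
                    ≤ ENNReal.ofReal K₉ * ∫⁻ ω, (1 + ‖X₀ ω‖ₑ ^ (4 * p)) ∂P := by
  have hp0 : 0 < p := by linarith
  -- An integer exponent above `p` that is still at most `q₀ / 2`; the integer part in the bound on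
  -- `p` makes room for it.
  obtain ⟨n, hpn, hnq⟩ : ∃ n : ℕ, p ≤ n ∧ (n : ℝ) ≤ q₀ / 2 := by
    refine ⟨⌈p⌉₊, Nat.le_ceil p, ?_⟩
    have h1 : ⌈p⌉ ≤ ⌊q₀ / 2⌋ := Int.ceil_le.2 hp'.le
    have h2 : ((⌈p⌉₊ : ℤ) : ℝ) = ⌈p⌉ := by rw [Int.natCast_ceil_eq_ceil hp0.le]
    have h3 : (⌈p⌉ : ℝ) ≤ ⌊q₀ / 2⌋ := by exact_mod_cast h1
    rw [Int.cast_natCast] at h2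
    rw [h2]
    exact h3.trans (Int.floor_le _)
  have hα : 4 * (2 * n - 1) * Lσ + a₂ < a₁ := by
    have h1 := hσ.2.1
    rw [lt_div_iff₀ (by linarith)] at h1
    have h2 : 4 * (2 * n - 1) * Lσ ≤ 5 * (2 * q₀ - 1) * Lσ :=
      mul_le_mul_of_nonneg_right (by linarith) hσ.1.le
    linarith
  set D := (C + 2 * (2 * n - 1) * hsNorm (σ 0 (dirac2 0)) ^ 2)
        / (a₁ - (4 * (2 * n - 1) * Lσ + a₂)) with hD
  have hD0 : 0 ≤ D := by
    have h1 : 0 ≤ C := hcoer.2.2.2.1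
    have h2 : (0 : ℝ) ≤ 2 * n - 1 := by linarith
    exact div_nonneg (by positivity) (sub_pos.2 hα).le
  refine ⟨2 ^ (p - 1) * (1 + D ^ p), by positivity, ?_⟩
  intro Ω _ P _ W X₀ _ _ hind _ N _ Wi X₀i hI h _ _ X hX k
  set S := ⨆ j, ∫⁻ ω, (1 + ‖X₀i j ω‖ₑ ^ (4 * p)) ∂P with hS
  refine ⟨iSup_le fun i => ?_, ?_⟩
  · have hS1 : 1 ≤ S := by
      refine le_trans ?_ (le_iSup (fun j => ∫⁻ ω, (1 + ‖X₀i j ω‖ₑ ^ (4 * p)) ∂P) i)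
      calc (1 : ℝ≥0∞) = ∫⁻ _, 1 ∂P := by simp
        _ ≤ _ := lintegral_mono fun ω => le_self_add
    have hinit : ∀ j, eLpNorm (fun ω => ‖X 0 j ω‖ ^ 2) (ENNReal.ofReal p) P ≤ S ^ p⁻¹ := by
      intro j
      rw [ENNReal.le_rpow_inv_iff hp0, eLpNorm_norm_sq_rpow _ hp0]
      calc ∫⁻ ω, ‖X 0 j ω‖ₑ ^ (2 * p) ∂P = ∫⁻ ω, ‖X₀i j ω‖ₑ ^ (2 * p) ∂P := by
            refine lintegral_congr_ae ?_
            filter_upwards [hX.init j] with ω hω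
            rw [hω]
        _ ≤ ∫⁻ ω, (1 + ‖X₀i j ω‖ₑ ^ (4 * p)) ∂P :=
            lintegral_mono fun ω => rpow_two_mul_le_one_add_rpow_four_mul _ hp0.le
        _ ≤ S := le_iSup (fun j => ∫⁻ ω, (1 + ‖X₀i j ω‖ₑ ^ (4 * p)) ∂P) j
    have hbound := hX.eLpNorm_le hI hind hmono hcoer (by linarith) hσ hp hpn hα hinit k i
    rw [← hD] at hbound
    calc ∫⁻ ω, ‖X k i ω‖ₑ ^ (2 * p) ∂P
        ≤ (S ^ p⁻¹ + ENNReal.ofReal D) ^ p := by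
          rw [← eLpNorm_norm_sq_rpow _ hp0]
          gcongr
      _ ≤ 2 ^ (p - 1) * ((S ^ p⁻¹) ^ p + ENNReal.ofReal D ^ p) :=
          ENNReal.rpow_add_le_mul_rpow_add_rpow _ _ hp
      _ ≤ 2 ^ (p - 1) * (S + ENNReal.ofReal (D ^ p) * S) := by
          rw [← ENNReal.rpow_mul, inv_mul_cancel₀ hp0.ne', ENNReal.rpow_one,
            ENNReal.ofReal_rpow_of_nonneg hD0 hp0.le]
          gcongr
          exact le_mul_of_one_le_right' hS1
      _ = ENNReal.ofReal (2 ^ (p - 1) * (1 + D ^ p)) * S := by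
          rw [ENNReal.ofReal_mul (by positivity), ENNReal.ofReal_add (by positivity)
            (by positivity), ENNReal.ofReal_one,
            ← ENNReal.ofReal_rpow_of_pos (by norm_num : (0 : ℝ) < 2), ENNReal.ofReal_ofNat]
          ring
  · gcongr
    refine iSup_le fun j => le_of_eq ?_
    exact ((hI.identDistrib j).comp (u := fun z : (ℝ≥0 → E m) × E d => 1 + ‖z.2‖ₑ ^ (4 * p))
      (by fun_prop)).lintegral_eq
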